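/- **Theorem (Recurrent and transient hypergeometric random walks).** Let $a,b,c,d\in\mathbb R$ satisfy $a,b>0$, $d>\max(a,b)$, $c\ge a$, $c+1\ge b$ and $c\neq b$, $c+1\ne b$, and put $\delta=c+d-a-b$ (so that $\delta>0$). On $[0,1]$ consider the weights and the measure $$w_1(x)={}_2F_1\!\left[{c-b,\;d-b\atop \delta};1-x\right],\qquad w_2(x)=\frac cb\,{}_2F_1\!\left[{c-b,\;d-b-1\atop \delta};1-x\right],$$ $$\mathrm d\mu(x)=\frac{\Gamma(c)\Gamma(d)}{\Gamma(a)\Gamma(b)\Gamma(\delta)}\,x^{a-1}(1-x)^{\delta-1}\,\mathrm dx .$$ Let $X=(1,x,x^2,\dots)^\top$, $X_1=(1,0,x,0,x^2,\dots)^\top$, $X_2=(0,1,0,x,0,x^2,\dots)^\top$, and let $g=\int_0^1 X\,(w_1X_1+w_2X_2)^\top\,\mathrm d\mu$ be the semi-infinite moment matrix. Then $g$ has a Gauss--Borel factorization $g=S^{-1}H\tilde S^{-\top}$ with $S,\tilde S$ lower unitriangular and $H$ diagonal with nonzero diagonal entries. For this factorization, let $B=SX$ be the sequence of monic type II multiple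 orthogonal polynomials $B^{(n)}$, let $A_1=H^{-1}\tilde SX_1$ and $A_2=H^{-1}\tilde SX_2$ be the sequences of type I polynomials, let $q^{(n)}=w_1A_1^{(n)}+w_2A_2^{(n)}$ be the linear forms of type I ($n=0,1,2,\dots$), and let $J=S\Lambda S^{-1}$ be the Jacobi matrix, where $\Lambda_{k,k+1}=1$ and all other entries of $\Lambda$ are $0$. Then $B^{(n)}(1)>0$ and $q^{(n)}(1)>0$ for all $n\ge 0$, and the matrices $$P_{I,n,m}=\frac{q^{(m)}(1)}{q^{(n)}(1)}\,J_{m,n},\qquad P_{II,n,m}=\frac{B^{(m)}(1)}{B^{(n)}(1)}\,J_{n,m}\qquad(n,m\ge 0)$$ are stochastic. Moreover, both Markov chains on $\{0,1,2,\dots\}$ with transition matrices $P_I$ and $P_{II}$ are recurrent (from each state the probability of ever returning to it is $1$) if $0<\delta\le 1$, and both are transient (from each state that probability is less than $1$) if $\delta>1$. -/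

import Mathlib

open MeasureTheory

noncomputable section

namespace HypergeometricWalk

/-! ### Semi-infinite matrices and the Gauss--Borel factorization -/

/-- The inverse of a lower triangular semi-infinite matrix with nonzero diagonal.  The inverses of
the leading square truncations of such a matrix are the truncations of its inverse, so the `(i, j)`
entry is read from the truncation of size `max i j + 1`. -/
def lowerInv (S : ℕ → ℕ → ℝ) (i j : ℕ) : ℝ :=
  (Matrix.of fun k l : Fin (max i j + 1) => S k l)⁻¹ ⟨i, by omega⟩ ⟨j, by omega⟩

/-- Lower unitriangular semi-infinite matrices. -/
structure IsLowerUnitriangular (S : ℕ → ℕ → ℝ) : Prop where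
  diag : ∀ i, S i i = 1
  lower : ∀ i j, i < j → S i j = 0

/-- `g = S⁻¹ H S̃⁻ᵀ` with `S`, `S̃` lower unitriangular and `H` diagonal with nonzero entries. -/
structure IsGaussBorel (g S : ℕ → ℕ → ℝ) (H : ℕ → ℝ) (St : ℕ → ℕ → ℝ) : Prop where
  left : IsLowerUnitriangular S
  right : IsLowerUnitriangular St
  ne_zero : ∀ n, H n ≠ 0
  factor : ∀ n m, g n m =
    ∑ k ∈ Finset.range (min n m + 1), lowerInv S n k * H k * lowerInv St m k

/-- The monic type II polynomials `B = S X`, where `X = (1, x, x², …)ᵀ`. -/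
def typeII (S : ℕ → ℕ → ℝ) (n : ℕ) : Polynomial ℝ :=
  ∑ i ∈ Finset.range (n + 1), Polynomial.C (S n i) * Polynomial.X ^ i

/-- The first type I polynomials `A₁ = H⁻¹ S̃ X₁`, where `X₁ = (1, 0, x, 0, x², …)ᵀ`. -/
def typeI₁ (H : ℕ → ℝ) (St : ℕ → ℕ → ℝ) (n : ℕ) : Polynomial ℝ :=
  ∑ i ∈ Finset.range (n / 2 + 1), Polynomial.C ((H n)⁻¹ * St n (2 * i)) * Polynomial.X ^ i

/-- The second type I polynomials `A₂ = H⁻¹ S̃ X₂`, where `X₂ = (0, 1, 0, x, 0, x², …)ᵀ`. -/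
def typeI₂ (H : ℕ → ℝ) (St : ℕ → ℕ → ℝ) (n : ℕ) : Polynomial ℝ :=
  ∑ i ∈ Finset.range ((n + 1) / 2), Polynomial.C ((H n)⁻¹ * St n (2 * i + 1)) * Polynomial.X ^ i

/-- The Jacobi matrix `J = S Λ S⁻¹`, with `Λ` the shift matrix (`Λ k (k + 1) = 1`, zero elsewhere). -/
def jacobi (S : ℕ → ℕ → ℝ) (n m : ℕ) : ℝ :=
  ∑ k ∈ Finset.range (n + 1), S n k * lowerInv S (k + 1) m

/-! ### The hypergeometric system of weights -/

/-- The parameter `δ = c + d - a - b`. -/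
def delta (a b c d : ℝ) : ℝ := c + d - a - b

/-- The weight `w₁`. -/
def w₁ (a b c d x : ℝ) : ℝ := ₂F₁ (c - b) (d - b) (delta a b c d) (1 - x)

/-- The weight `w₂`. -/
def w₂ (a b c d x : ℝ) : ℝ := c / b * ₂F₁ (c - b) (d - b - 1) (delta a b c d) (1 - x)

/-- The measure
`Γ(c) Γ(d) / (Γ(a) Γ(b) Γ(δ)) * x ^ (a - 1) * (1 - x) ^ (δ - 1) dx` on `[0, 1]`. -/
def mu (a b c d : ℝ) : Measure ℝ :=
  (volume.restrict (Set.Icc 0 1)).withDensity fun x => ENNReal.ofReal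
    (Real.Gamma c * Real.Gamma d / (Real.Gamma a * Real.Gamma b * Real.Gamma (delta a b c d)) *
      x ^ (a - 1) * (1 - x) ^ (delta a b c d - 1))

/-- The entries of `ξ = (w₁, w₂, x w₁, x w₂, x² w₁, …)ᵀ`. -/
def xi (a b c d : ℝ) (j : ℕ) (x : ℝ) : ℝ :=
  x ^ (j / 2) * if Even j then w₁ a b c d x else w₂ a b c d x

/-- The moment matrix `g = ∫ X ξᵀ dμ`. -/
def moment (a b c d : ℝ) (i j : ℕ) : ℝ := ∫ x, x ^ i * xi a b c d j x ∂(mu a b c d)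

/-- The linear forms of type I, `q⁽ⁿ⁾ = w₁ A₁⁽ⁿ⁾ + w₂ A₂⁽ⁿ⁾`. -/
def linearForm (a b c d : ℝ) (H : ℕ → ℝ) (St : ℕ → ℕ → ℝ) (n : ℕ) (x : ℝ) : ℝ :=
  w₁ a b c d x * (typeI₁ H St n).eval x + w₂ a b c d x * (typeI₂ H St n).eval x

/-- The transition matrix of type II, `P_{II,n,m} = B⁽ᵐ⁾(1) / B⁽ⁿ⁾(1) * J_{n,m}`. -/
def transitionII (S : ℕ → ℕ → ℝ) (n m : ℕ) : ℝ :=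
  (typeII S m).eval 1 / (typeII S n).eval 1 * jacobi S n m

/-- The transition matrix of type I, `P_{I,n,m} = q⁽ᵐ⁾(1) / q⁽ⁿ⁾(1) * J_{m,n}`. -/
def transitionI (a b c d : ℝ) (S : ℕ → ℕ → ℝ) (H : ℕ → ℝ) (St : ℕ → ℕ → ℝ) (n m : ℕ) : ℝ :=
  linearForm a b c d H St m 1 / linearForm a b c d H St n 1 * jacobi S m n

/-! ### Markov chains on the nonnegative integers -/

/-- Stochastic (Markov transition) matrices indexed by `ℕ`. -/
structure IsStochastic (P : ℕ → ℕ → ℝ) : Prop where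
  nonneg : ∀ n m, 0 ≤ P n m
  hasSum_row : ∀ n, HasSum (P n) 1

/-- `firstPassage P r i j` is the probability that the chain with transition matrix `P`, started at
`i`, is at `j` at time `r` and is not at `j` at any of the times `1, …, r - 1`. -/
def firstPassage (P : ℕ → ℕ → ℝ) : ℕ → ℕ → ℕ → ℝ
  | 0, _, _ => 0
  | 1, i, j => P i j
  | r + 2, i, j => ∑' k, if k = j then 0 else P i k * firstPassage P (r + 1) k j

/-- A chain is recurrent if, from every state, it returns to that state with probability `1`. -/
def IsRecurrent (P : ℕ → ℕ → ℝ) : Prop :=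
  ∀ n, HasSum (fun r => firstPassage P r n n) 1

/-- A chain is transient if, from every state, it returns to that state with probability less
than `1`. -/
def IsTransient (P : ℕ → ℕ → ℝ) : Prop :=
  ∀ n, ∃ p : ℝ, p < 1 ∧ HasSum (fun r => firstPassage P r n n) p

end HypergeometricWalk

end

noncomputable section

namespace HypergeometricWalk

open Finset Filter Topology

/-! ### First passage decompositions -/

/-! By Gauss's summation theorem the moments of w₁ are R(s) = (a)_s (b)_s / ((c)_s (d)_s), and
column j of g is R(s) times a rational function of s with numerator of degree j and poles -e₀, …,
-e_{j-1}, where e = (c, d, c+1, d+1, …) (`moment_eq`). Since (S⁻¹)_{s,m} is the s-th moment of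
q^(m), it is R(s) times a rational function with m prescribed poles, with zeros 0, …, m-1 by
orthogonality, and with value q^(m)(1) at infinity, because the columns tend to 1 = w₁(1) or c/b =
w₂(1). Hence (S⁻¹)_{s,m} = R(s) q^(m)(1) r_m(s) with r_m = `ratFun e m`
(`IsGaussBorel.lowerInv_eq_ratFun`), and the unit diagonal forces q^(m)(1) > 0.

A product of one pure death and two pure birth matrices maps n ↦ r_n(s) to n ↦ R(s+1)/R(s) ·
r_n(s+1) (`IsAdmissible.walk_ratFun`). Compared with S⁻¹J = ΛS⁻¹, this identifies P_I with that
product (`mul_jacobi_eq_kernel`); so P_I is stochastic and J is nonnegative. As J B(1) = B(1), the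
vector B^(n)(1) q^(n)(1) is invariant under P_I, and balancing the flow across each cut makes it
positive (`invariant_pos`). Thus B^(n)(1) > 0 and P_II is stochastic.

Both chains have the return probabilities (J^r)_{jj} = Σ_k S_{jk} (S⁻¹)_{k+r,j}. Since R(s) decays
like s^{-δ}, these are asymptotic to a positive multiple of r^{-δ}, so the Green function converges
exactly when δ > 1. The renewal equation (`sum_matPow_eq`) translates this into transience or
recurrence. -/

/-- The powers of a matrix indexed by `ℕ`. -/
def matPow (P : ℕ → ℕ → ℝ) : ℕ → ℕ → ℕ → ℝ
  | 0, i, j => if i = j then 1 else 0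
  | r + 1, i, j => ∑' k, P i k * matPow P r k j

section Markov

variable {P : ℕ → ℕ → ℝ}

lemma summable_row_mul (hP : ∀ i, (Function.support (P i)).Finite) (i : ℕ) (φ : ℕ → ℝ) :
    Summable fun k => P i k * φ k :=
  summable_of_hasFiniteSupport ((hP i).subset fun k hk h => hk (by simp [h]))

lemma summable_row_ite (hP : ∀ i, (Function.support (P i)).Finite) (i j : ℕ) (φ : ℕ → ℝ) :
    Summable fun k => if k = j then 0 else P i k * φ k :=
  summable_of_hasFiniteSupport ((hP i).subset fun k hk h => hk (by simp [h]))

lemma matPow_nonneg (h0 : ∀ i j, 0 ≤ P i j) (r i j : ℕ) : 0 ≤ matPow P r i j := by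
  induction r generalizing i with
  | zero => simp only [matPow]; split_ifs <;> norm_num
  | succ r ih => exact tsum_nonneg fun k => mul_nonneg (h0 i k) (ih k)

lemma firstPassage_nonneg (h0 : ∀ i j, 0 ≤ P i j) (r i j : ℕ) : 0 ≤ firstPassage P r i j := by
  induction r generalizing i with
  | zero => simp [firstPassage]
  | succ r ih =>
    cases r with
    | zero => exact h0 i j
    | succ r =>
      refine tsum_nonneg fun k => ?_
      split_ifs
      · exact le_rfl
      · exact mul_nonneg (h0 i k) (ih k)

lemma tsum_row_eq_add (hP : ∀ i, (Function.support (P i)).Finite) (i j : ℕ) (φ : ℕ → ℝ) :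
    ∑' k, P i k * φ k = P i j * φ j + ∑' k, if k = j then 0 else P i k * φ k :=
  (summable_row_mul hP i φ).tsum_eq_add_tsum_ite j

/-- Decomposition of a path according to its first visit to its final state. -/
lemma matPow_eq_sum_firstPassage (hP : ∀ i, (Function.support (P i)).Finite) (r i j : ℕ) :
    matPow P (r + 1) i j =
      ∑ l ∈ range (r + 1), firstPassage P (l + 1) i j * matPow P (r - l) j j := by
  induction r generalizing i with
  | zero =>
    simp [matPow, firstPassage]
  | succ r ih =>
    rw [matPow, tsum_row_eq_add hP i j, sum_range_succ', add_comm]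
    simp only [firstPassage, Nat.sub_zero, Nat.add_sub_add_right]
    congr 1
    simp only [ih, ← tsum_mul_right]
    rw [← Summable.tsum_finsetSum]
    · refine tsum_congr fun k => ?_
      split_ifs with h
      · simp
      · simp [mul_sum, mul_assoc]
    · intro l _
      refine (summable_row_ite hP i j
        (fun k => firstPassage P (l + 1) k j * matPow P (r - l) j j)).congr fun k => ?_
      split_ifs <;> simp [mul_assoc]

/-- Condition on the first step: it either hits `j`, or lands on some `k ≠ j`, from which the
shorter partial sum is at most 1 by induction. -/
lemma sum_firstPassage_le_one (hP : ∀ i, (Function.support (P i)).Finite) (hs : IsStochastic P)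
    (r i j : ℕ) : ∑ l ∈ range r, firstPassage P (l + 1) i j ≤ 1 := by
  induction r generalizing i with
  | zero => simp
  | succ r ih =>
    rw [sum_range_succ']
    simp only [firstPassage]
    rw [← Summable.tsum_finsetSum
      fun l _ => summable_row_ite hP i j fun k => firstPassage P (l + 1) k j]
    have h1 := tsum_row_eq_add hP i j fun _ => 1
    simp only [mul_one, (hs.hasSum_row i).tsum_eq] at h1
    rw [h1, add_comm]
    refine add_le_add le_rfl ?_
    refine Summable.tsum_le_tsum (fun k => ?_) ?_ (by simpa using summable_row_ite hP i j fun _ => 1)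
    · split_ifs with h
      · simp
      · rw [← mul_sum]
        exact mul_le_of_le_one_right (hs.nonneg i k) (ih k)
    · exact summable_sum fun l _ => summable_row_ite hP i j fun k => firstPassage P (l + 1) k j

/-- The renewal equation for the partial sums of the Green function. -/
lemma sum_matPow_eq (hP : ∀ i, (Function.support (P i)).Finite) (N j : ℕ) :
    ∑ r ∈ range (N + 1), matPow P r j j = 1 + ∑ l ∈ range N, firstPassage P (l + 1) j j *
      ∑ r ∈ range (N - l), matPow P r j j := by
  induction N with
  | zero => simp [matPow]
  | succ N ih =>
    rw [sum_range_succ, ih, matPow_eq_sum_firstPassage hP, add_assoc]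
    congr 1
    -- The added term `l = N` has an empty inner sum.
    have h : ∑ l ∈ range N, firstPassage P (l + 1) j j * ∑ r ∈ range (N - l), matPow P r j j =
        ∑ l ∈ range (N + 1), firstPassage P (l + 1) j j *
          ∑ r ∈ range (N - l), matPow P r j j := by
      rw [sum_range_succ]; simp
    rw [h, ← sum_add_distrib]
    refine sum_congr rfl fun l hl => ?_
    rw [← mul_add, Nat.succ_sub (by simpa [Nat.lt_succ_iff] using hl), sum_range_succ]

lemma summable_firstPassage (hP : ∀ i, (Function.support (P i)).Finite) (hs : IsStochastic P)
    (j : ℕ) : Summable fun l => firstPassage P (l + 1) j j :=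
  summable_of_sum_range_le (fun _ => firstPassage_nonneg hs.nonneg _ _ _)
    fun r => sum_firstPassage_le_one hP hs r j j

lemma tsum_firstPassage_le_one (hP : ∀ i, (Function.support (P i)).Finite) (hs : IsStochastic P)
    (j : ℕ) : ∑' l, firstPassage P (l + 1) j j ≤ 1 :=
  Real.tsum_le_of_sum_range_le (fun _ => firstPassage_nonneg hs.nonneg _ _ _)
    fun r => sum_firstPassage_le_one hP hs r j j

lemma hasSum_firstPassage (hP : ∀ i, (Function.support (P i)).Finite) (hs : IsStochastic P)
    (j : ℕ) : HasSum (fun r => firstPassage P r j j) (∑' l, firstPassage P (l + 1) j j) := by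
  rw [← hasSum_nat_add_iff' 1]
  simpa [firstPassage] using (summable_firstPassage hP hs j).hasSum

/-- A chain whose Green function diverges on the diagonal is recurrent. -/
theorem isRecurrent_of_not_summable (hP : ∀ i, (Function.support (P i)).Finite)
    (hs : IsStochastic P) (h : ∀ j, ¬ Summable fun r => matPow P r j j) : IsRecurrent P := by
  intro j
  have hF := hasSum_firstPassage hP hs j
  have hle := tsum_firstPassage_le_one hP hs j
  set F := ∑' l, firstPassage P (l + 1) j j with hFdef
  rcases hle.eq_or_lt with h1 | h1
  · rwa [h1] at hF
  -- If `F < 1`, the renewal equation gives U ≤ 1 + F U for each partial sum U of the Green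
  -- function, hence the bound 1 / (1 - F).
  · refine (h j (summable_of_sum_range_le (c := 1 / (1 - F)) (fun _ => matPow_nonneg hs.nonneg _ _ _)
      fun N => ?_)).elim
    have hmono : Monotone fun N => ∑ r ∈ range N, matPow P r j j := fun a b hab =>
      sum_le_sum_of_subset_of_nonneg (range_mono hab) fun _ _ _ => matPow_nonneg hs.nonneg _ _ _
    refine (hmono (Nat.le_succ N)).trans ?_
    rw [le_div_iff₀ (by linarith)]
    have hU0 : 0 ≤ ∑ r ∈ range (N + 1), matPow P r j j :=
      sum_nonneg fun _ _ => matPow_nonneg hs.nonneg _ _ _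
    have h2 : ∑ l ∈ range N, firstPassage P (l + 1) j j * ∑ r ∈ range (N - l), matPow P r j j ≤
        F * ∑ r ∈ range (N + 1), matPow P r j j := by
      calc _ ≤ ∑ l ∈ range N, firstPassage P (l + 1) j j * ∑ r ∈ range (N + 1), matPow P r j j := by
            refine sum_le_sum fun l _ => mul_le_mul_of_nonneg_left (hmono (by omega))
              (firstPassage_nonneg hs.nonneg _ _ _)
        _ ≤ _ := by
            rw [← sum_mul]
            exact mul_le_mul_of_nonneg_right ((summable_firstPassage hP hs j).sum_le_tsum _
              fun _ _ => firstPassage_nonneg hs.nonneg _ _ _) hU0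
    have h3 := sum_matPow_eq hP N j
    simp only [Nat.succ_eq_add_one]
    linarith

/-- A chain whose Green function converges on the diagonal is transient. -/
theorem isTransient_of_summable (hP : ∀ i, (Function.support (P i)).Finite)
    (hs : IsStochastic P) (h : ∀ j, Summable fun r => matPow P r j j) : IsTransient P := by
  intro j
  refine ⟨_, ?_, hasSum_firstPassage hP hs j⟩
  set F := ∑' l, firstPassage P (l + 1) j j with hFdef
  set U := ∑' r, matPow P r j j with hUdef
  have hmono : Monotone fun N => ∑ r ∈ range N, matPow P r j j := fun a b hab =>
    sum_le_sum_of_subset_of_nonneg (range_mono hab) fun _ _ _ => matPow_nonneg hs.nonneg _ _ _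
  have hN : ∀ N, 1 + (∑ l ∈ range N, firstPassage P (l + 1) j j) *
      ∑ r ∈ range N, matPow P r j j ≤ U := by
    intro N
    -- In the renewal sum up to 2N, every `l < N` still leaves at least `N` terms in the inner sum,
    -- so the product of the two partial sums is dominated.
    calc _ ≤ 1 + ∑ l ∈ range (N + N), firstPassage P (l + 1) j j *
          ∑ r ∈ range (N + N - l), matPow P r j j := by
          gcongr
          rw [sum_mul]
          refine (sum_le_sum (g := fun l => firstPassage P (l + 1) j j *
            ∑ r ∈ range (N + N - l), matPow P r j j) fun l hl => ?_).trans
            (sum_le_sum_of_subset_of_nonneg (range_mono (by omega)) fun l _ _ =>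
              mul_nonneg (firstPassage_nonneg hs.nonneg _ _ _)
                (sum_nonneg fun _ _ => matPow_nonneg hs.nonneg _ _ _))
          exact mul_le_mul_of_nonneg_left (hmono (by simp at hl; omega))
            (firstPassage_nonneg hs.nonneg _ _ _)
      _ ≤ U := by
          rw [← sum_matPow_eq hP]
          exact (h j).sum_le_tsum _ fun _ _ => matPow_nonneg hs.nonneg _ _ _
  have hlim : 1 + F * U ≤ U := le_of_tendsto' (tendsto_const_nhds.add
    ((summable_firstPassage hP hs j).hasSum.tendsto_sum_nat.mul (h j).hasSum.tendsto_sum_nat)) hN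
  have hU : 0 ≤ U := tsum_nonneg fun _ => matPow_nonneg hs.nonneg _ _ _
  by_contra hc
  nlinarith [mul_le_mul_of_nonneg_right (not_lt.mp hc) hU]

/-- A signed invariant measure of a chain with downward jumps of size one, positive at the origin,
is positive everywhere if every state can be left both upwards and downwards. -/
lemma invariant_pos (hs : IsStochastic P) (hlow : ∀ m n, n + 1 < m → P m n = 0)
    (hdown : ∀ n, 0 < P (n + 1) n) (hup : ∀ n, 0 < P n (n + 2)) {p : ℕ → ℝ} (hp0 : 0 < p 0)
    (hp : ∀ n, ∑ m ∈ range (n + 2), p m * P m n = p n) (n : ℕ) : 0 < p n := by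
  induction n using Nat.strong_induction_on with
  | _ n ih =>
    cases n with
    | zero => exact hp0
    | succ n =>
      -- Sum the invariance equations over {0, …, n}: the only inflow from outside comes from `n +
      -- 1` and enters at `n`.
      have h1 : ∑ k ∈ range (n + 1), p k =
          ∑ m ∈ range (n + 1), p m * ∑ k ∈ range (n + 1), P m k + p (n + 1) * P (n + 1) n := by
        calc _ = ∑ k ∈ range (n + 1), ∑ m ∈ range (n + 2), p m * P m k := by
              refine sum_congr rfl fun k hk => ?_
              rw [← hp k]
              refine sum_subset (range_mono (by simp at hk; omega)) fun m _ hm => ?_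
              rw [hlow m k (by simp at hm; omega), mul_zero]
          _ = _ := by
              rw [sum_comm, sum_range_succ]
              simp only [← mul_sum]
              congr 2
              rw [sum_range_succ, sum_eq_zero, zero_add]
              intro k hk
              exact hlow _ _ (by simp at hk; omega)
      -- The outflow from {0, …, n} is positive, since `n` can jump to `n + 2`.
      have h2 : 0 < ∑ m ∈ range (n + 1), p m * (1 - ∑ k ∈ range (n + 1), P m k) := by
        have hle : ∀ m, ∑ k ∈ range (n + 1), P m k ≤ 1 := fun m =>
          sum_le_hasSum _ (fun k _ => hs.nonneg m k) (hs.hasSum_row m)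
        refine sum_pos' (fun m hm => mul_nonneg (ih m (by simpa using hm)).le
          (sub_nonneg.2 (hle m))) ⟨n, by simp, mul_pos (ih n (by omega)) (sub_pos.2 ?_)⟩
        have h3 := sum_le_hasSum (range (n + 3)) (fun k _ => hs.nonneg n k) (hs.hasSum_row n)
        rw [sum_range_succ, sum_range_succ] at h3
        linarith [hup n, hs.nonneg n (n + 1)]
      have h3 : p (n + 1) * P (n + 1) n =
          ∑ m ∈ range (n + 1), p m * (1 - ∑ k ∈ range (n + 1), P m k) := by
        simp only [mul_sub, mul_one, sum_sub_distrib]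
        linarith
      rw [← h3] at h2
      exact pos_of_mul_pos_left h2 (hdown n).le

end Markov

/-! ### Inverses of lower unitriangular matrices -/

section LowerInverse

variable {S T g : ℕ → ℕ → ℝ}

/-- Forward substitution. -/
def forwardSubst (S : ℕ → ℕ → ℝ) (i j : ℕ) : ℝ :=
  (if i = j then 1 else 0) - ∑ k : Fin i, S i k * forwardSubst S k j
termination_by i
decreasing_by exact k.2

lemma forwardSubst_mul (hS : IsLowerUnitriangular S) (i j : ℕ) :
    ∑ k ∈ range (i + 1), S i k * forwardSubst S k j = if i = j then 1 else 0 := by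
  rw [sum_range_succ, hS.diag, one_mul, forwardSubst,
    Fin.sum_univ_eq_sum_range (fun k => S i k * forwardSubst S k j)]
  ring

lemma forwardSubst_eq_zero (S : ℕ → ℕ → ℝ) {i j : ℕ} (h : i < j) : forwardSubst S i j = 0 := by
  induction i using Nat.strong_induction_on with
  | _ i ih =>
    rw [forwardSubst, if_neg h.ne, sum_eq_zero, sub_zero]
    intro k _
    rw [ih k k.2 (k.2.trans h), mul_zero]

lemma isLowerUnitriangular_forwardSubst (hS : IsLowerUnitriangular S) :
    IsLowerUnitriangular (forwardSubst S) := by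
  refine ⟨fun i => ?_, fun i j h => forwardSubst_eq_zero S h⟩
  have h := forwardSubst_mul hS i i
  rwa [sum_range_succ, hS.diag, one_mul, if_pos rfl, sum_eq_zero, zero_add] at h
  intro k hk
  rw [forwardSubst_eq_zero S (by simpa using hk), mul_zero]

lemma sum_truncate {φ : ℕ → ℝ} {m n : ℕ} (hmn : m ≤ n) (h : ∀ k, m ≤ k → φ k = 0) :
    ∑ k ∈ range n, φ k = ∑ k ∈ range m, φ k :=
  (sum_subset (range_mono hmn) fun k _ hk => h k (by simpa using hk)).symm

/-- Lower triangularity makes truncation multiplicative, which reduces questions about semi-infinite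
inverses to finite matrices. -/
lemma truncation_mul_eq_one (hS : IsLowerUnitriangular S)
    (h : ∀ i j, ∑ k ∈ range (i + 1), S i k * T k j = if i = j then 1 else 0) (N : ℕ) :
    (Matrix.of fun k l : Fin N => S k l) * (Matrix.of fun k l : Fin N => T k l) = 1 := by
  ext i j
  rw [Matrix.mul_apply, Matrix.one_apply]
  simp only [Matrix.of_apply]
  rw [Fin.sum_univ_eq_sum_range (fun k => S i k * T k j),
    sum_truncate (Nat.succ_le_of_lt i.2) fun k hk => by rw [hS.lower _ _ hk, zero_mul], h]
  simp [Fin.ext_iff]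

lemma lowerInv_eq_of_mul (hS : IsLowerUnitriangular S)
    (h : ∀ i j, ∑ k ∈ range (i + 1), S i k * T k j = if i = j then 1 else 0) :
    lowerInv S = T := by
  funext i j
  rw [lowerInv, Matrix.inv_eq_right_inv (truncation_mul_eq_one hS h _)]
  rfl

/-- A one-sided inverse of a finite square matrix is two-sided; apply this to truncations. -/
lemma mul_comm_of_mul (hS : IsLowerUnitriangular S) (hT : IsLowerUnitriangular T)
    (h : ∀ i j, ∑ k ∈ range (i + 1), S i k * T k j = if i = j then 1 else 0) (i j : ℕ) :
    ∑ k ∈ range (i + 1), T i k * S k j = if i = j then 1 else 0 := by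
  have h1 := mul_eq_one_comm.1 (truncation_mul_eq_one hS h (max i j + 1))
  have h2 := congrFun (congrFun h1 ⟨i, by omega⟩) ⟨j, by omega⟩
  rw [Matrix.mul_apply, Matrix.one_apply] at h2
  simp only [Matrix.of_apply, Fin.mk.injEq] at h2
  rw [Fin.sum_univ_eq_sum_range (fun k => T i k * S k j),
    sum_truncate (m := i + 1) (by omega) fun k hk => by rw [hT.lower _ _ hk, zero_mul]] at h2
  exact h2

lemma lowerInv_eq_forwardSubst (hS : IsLowerUnitriangular S) : lowerInv S = forwardSubst S :=
  lowerInv_eq_of_mul hS (forwardSubst_mul hS)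

lemma IsLowerUnitriangular.lowerInv (hS : IsLowerUnitriangular S) :
    IsLowerUnitriangular (lowerInv S) := by
  rw [lowerInv_eq_forwardSubst hS]
  exact isLowerUnitriangular_forwardSubst hS

lemma mul_lowerInv (hS : IsLowerUnitriangular S) (i j : ℕ) :
    ∑ k ∈ range (i + 1), S i k * lowerInv S k j = if i = j then 1 else 0 := by
  rw [lowerInv_eq_forwardSubst hS]
  exact forwardSubst_mul hS i j

lemma lowerInv_mul (hS : IsLowerUnitriangular S) (i j : ℕ) :
    ∑ k ∈ range (i + 1), lowerInv S i k * S k j = if i = j then 1 else 0 :=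
  mul_comm_of_mul hS hS.lowerInv (mul_lowerInv hS) i j

lemma lowerInv_lowerInv (hS : IsLowerUnitriangular S) : lowerInv (lowerInv S) = S :=
  lowerInv_eq_of_mul hS.lowerInv (lowerInv_mul hS)

/-- An `LU` factorization gives a Gauss--Borel factorization. -/
lemma isGaussBorel_of_mul {L U : ℕ → ℕ → ℝ} (hL : IsLowerUnitriangular L)
    (hU : ∀ i j, j < i → U i j = 0) (hd : ∀ i, U i i ≠ 0)
    (h : ∀ n m, g n m = ∑ k ∈ range (m + 1), L n k * U k m) :
    IsGaussBorel g (lowerInv L) (fun n => U n n) (lowerInv fun m k => U k m / U k k) := by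
  have hT : IsLowerUnitriangular fun m k => U k m / U k k :=
    ⟨fun i => div_self (hd i), fun i j hij => by simp [hU j i hij]⟩
  refine ⟨hL.lowerInv, hT.lowerInv, hd, fun n m => ?_⟩
  rw [lowerInv_lowerInv hL, lowerInv_lowerInv hT, h]
  rw [sum_truncate (m := min n m + 1) (by omega)]
  · refine sum_congr rfl fun k _ => ?_
    rw [mul_assoc, mul_div_cancel₀ _ (hd k)]
  · intro k hk
    rcases Nat.lt_or_ge n k with h1 | h1
    · rw [hL.lower _ _ h1, zero_mul]
    · rw [hU _ _ (by omega), mul_zero]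

/-- The moments of the linear forms of type I are the entries of `S⁻¹`. -/
lemma IsGaussBorel.lowerInv_eq {H : ℕ → ℝ} {St : ℕ → ℕ → ℝ} (h : IsGaussBorel g S H St)
    (s m : ℕ) : HypergeometricWalk.lowerInv S s m =
      ∑ j ∈ range (m + 1), (H m)⁻¹ * St m j * g s j := by
  have hg : ∀ j, g s j = ∑ k ∈ range (s + 1),
      HypergeometricWalk.lowerInv S s k * H k * HypergeometricWalk.lowerInv St j k := by
    intro j
    rw [h.factor, sum_truncate (n := s + 1) (m := min s j + 1) (by omega)]
    intro k hk
    rcases Nat.lt_or_ge s k with h1 | h1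
    · rw [h.left.lowerInv.lower _ _ h1, zero_mul, zero_mul]
    · rw [h.right.lowerInv.lower _ _ (by omega), mul_zero]
  simp only [hg, mul_sum]
  rw [sum_comm]
  -- Multiplying g = S⁻¹ H S̃⁻ᵀ on the right by S̃ᵀ H⁻¹ leaves S⁻¹.
  have h2 : ∀ k, ∑ j ∈ range (m + 1), (H m)⁻¹ * St m j *
      (HypergeometricWalk.lowerInv S s k * H k * HypergeometricWalk.lowerInv St j k) =
      if m = k then HypergeometricWalk.lowerInv S s m else 0 := by
    intro k
    have := mul_lowerInv h.right m k
    calc _ = (H m)⁻¹ * (HypergeometricWalk.lowerInv S s k * H k) *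
          ∑ j ∈ range (m + 1), St m j * HypergeometricWalk.lowerInv St j k := by
          rw [mul_sum]; exact sum_congr rfl fun _ _ => by ring
      _ = _ := by
          rw [this]
          split_ifs with hk
          · subst hk; field_simp [h.ne_zero m]
          · simp
  simp only [h2]
  rw [sum_ite_eq]
  split_ifs with hm
  · rfl
  · exact h.left.lowerInv.lower _ _ (by simpa [Nat.lt_succ_iff] using hm)

end LowerInverse

/-! ### Powers of the Jacobi matrix -/

section Jacobi

variable {S : ℕ → ℕ → ℝ}

/-- The entries of `S Λʳ S⁻¹`. -/
def jacobiPow (S : ℕ → ℕ → ℝ) (r n m : ℕ) : ℝ :=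
  ∑ k ∈ range (n + 1), S n k * lowerInv S (k + r) m

lemma jacobi_eq_zero (hS : IsLowerUnitriangular S) {n m : ℕ} (h : n + 1 < m) :
    jacobi S n m = 0 :=
  sum_eq_zero fun k hk => by
    rw [hS.lowerInv.lower _ _ (by simp at hk; omega), mul_zero]

lemma jacobi_succ (hS : IsLowerUnitriangular S) (n : ℕ) : jacobi S n (n + 1) = 1 := by
  rw [jacobi, sum_range_succ, hS.diag, hS.lowerInv.diag, sum_eq_zero]
  · norm_num
  · intro k hk
    rw [hS.lowerInv.lower _ _ (by simp at hk; omega), mul_zero]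

lemma jacobiPow_zero (hS : IsLowerUnitriangular S) (n m : ℕ) :
    jacobiPow S 0 n m = if n = m then 1 else 0 :=
  mul_lowerInv hS n m

/-- `S⁻¹ J = Λ S⁻¹`. -/
lemma lowerInv_mul_jacobi (hS : IsLowerUnitriangular S) (s m : ℕ) :
    ∑ k ∈ range (s + 1), lowerInv S s k * jacobi S k m = lowerInv S (s + 1) m := by
  have h : ∀ k ∈ range (s + 1), lowerInv S s k * jacobi S k m =
      ∑ l ∈ range (s + 1), lowerInv S s k * S k l * lowerInv S (l + 1) m := by
    intro k hk
    rw [jacobi, mul_sum, sum_truncate (n := s + 1) (m := k + 1) (by simp at hk; omega)]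
    · exact sum_congr rfl fun _ _ => by ring
    · intro l hl
      rw [hS.lower _ _ hl, mul_zero, zero_mul]
  rw [sum_congr rfl h, sum_comm]
  simp only [← sum_mul, lowerInv_mul hS]
  simp

/-- `J S = S Λ`. -/
lemma jacobi_mul (hS : IsLowerUnitriangular S) (n p : ℕ) :
    ∑ m ∈ range (n + 2), jacobi S n m * S m p =
      ∑ k ∈ range (n + 1), S n k * if k + 1 = p then 1 else 0 := by
  simp only [jacobi, sum_mul]
  rw [sum_comm]
  refine sum_congr rfl fun k hk => ?_
  rw [← lowerInv_mul hS (k + 1) p, mul_sum,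
    sum_truncate (n := n + 2) (m := k + 1 + 1) (by simp at hk; omega)]
  · exact sum_congr rfl fun _ _ => by ring
  · intro l hl
    rw [hS.lowerInv.lower _ _ hl, mul_zero, zero_mul]

/-- Row `n` of S Λʳ S⁻¹ ends at column `n + r`. Multiplication on this side serves the type I chain,
whose matrix involves the transpose of J; `jacobi_mul_jacobiPow` serves type II. -/
lemma jacobiPow_mul_jacobi (hS : IsLowerUnitriangular S) (r n m : ℕ) :
    ∑ k ∈ range (n + r + 1), jacobiPow S r n k * jacobi S k m = jacobiPow S (r + 1) n m := by
  simp only [jacobiPow, sum_mul]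
  rw [sum_comm]
  refine sum_congr rfl fun l hl => ?_
  rw [← add_assoc, ← lowerInv_mul_jacobi hS, mul_sum,
    sum_truncate (n := n + r + 1) (m := l + r + 1) (by simp at hl; omega)]
  · exact sum_congr rfl fun _ _ => by ring
  · intro k hk
    rw [hS.lowerInv.lower _ _ hk, mul_zero, zero_mul]

lemma jacobi_mul_jacobiPow (hS : IsLowerUnitriangular S) (r n m : ℕ) :
    ∑ k ∈ range (n + 2), jacobi S n k * jacobiPow S r k m = jacobiPow S (r + 1) n m := by
  have h : ∀ k ∈ range (n + 2), jacobi S n k * jacobiPow S r k m =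
      ∑ l ∈ range (n + 2), jacobi S n k * S k l * lowerInv S (l + r) m := by
    intro k hk
    rw [jacobiPow, mul_sum, sum_truncate (n := n + 2) (m := k + 1) (by simp at hk; omega)]
    · exact sum_congr rfl fun _ _ => by ring
    · intro l hl
      rw [hS.lower _ _ hl, mul_zero, zero_mul]
  rw [sum_congr rfl h, sum_comm]
  simp only [← sum_mul, jacobi_mul hS, jacobiPow]
  simp only [sum_mul]
  rw [sum_comm]
  refine sum_congr rfl fun k hk => ?_
  simp only [mul_ite, mul_one, mul_zero, ite_mul, zero_mul]
  rw [sum_ite_eq, if_pos (by simp at hk ⊢; omega), add_assoc, add_comm 1 r]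

end Jacobi

/-! ### Pochhammer symbols -/

/-- The rising factorial `(α)ₙ`. -/
abbrev poch (α : ℝ) (n : ℕ) : ℝ := (ascPochhammer ℝ n).eval α

lemma poch_succ (α : ℝ) (n : ℕ) : poch α (n + 1) = poch α n * (α + n) :=
  ascPochhammer_succ_eval n α

lemma poch_eq_prod (α : ℝ) (n : ℕ) : poch α n = ∏ j ∈ range n, (α + j) := by
  induction n with
  | zero => simp [poch]
  | succ n ih => rw [poch_succ, prod_range_succ, ih]

lemma poch_pos {α : ℝ} (h : 0 < α) (n : ℕ) : 0 < poch α n := by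
  rw [poch_eq_prod]
  exact prod_pos fun j _ => by positivity

lemma poch_add_one_left (α : ℝ) (n : ℕ) : α * poch (α + 1) n = poch α n * (α + n) := by
  induction n with
  | zero => simp [poch]
  | succ n ih =>
    rw [poch_succ, poch_succ, ← mul_assoc, ih]
    push_cast
    ring

lemma Gamma_add_nat {z : ℝ} (hz : 0 < z) (n : ℕ) :
    Real.Gamma (z + n) = Real.Gamma z * poch z n := by
  induction n with
  | zero => simp [poch]
  | succ n ih =>
    rw [Nat.cast_succ, ← add_assoc, Real.Gamma_add_one (by positivity), ih, poch_succ]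
    ring

/-- Euler's limit formula for the reciprocal of the Gamma function. -/
lemma tendsto_poch_div (α : ℝ) :
    Tendsto (fun n : ℕ => poch α (n + 1) / ((n : ℝ) ^ α * n.factorial)) atTop
      (𝓝 (Real.Gamma α)⁻¹) := by
  by_cases hα : ∃ m : ℕ, α = -m
  -- At its poles `Real.Gamma` has the value 0, whose inverse 0 agrees with the eventually vanishing
  -- Pochhammer symbols.
  · obtain ⟨m, rfl⟩ := hα
    rw [Real.Gamma_neg_nat_eq_zero, inv_zero]
    refine tendsto_const_nhds.congr' ?_
    filter_upwards [eventually_ge_atTop m] with n hn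
    rw [poch_eq_prod, prod_eq_zero (i := m) (by simp; omega) (by simp), zero_div]
  · push Not at hα
    refine ((Real.GammaSeq_tendsto_Gamma α).inv₀ (Real.Gamma_ne_zero hα)).congr fun n => ?_
    rw [Real.GammaSeq, inv_div, poch_eq_prod]

/-! ### Gauss's summation theorem -/

/-- The terms of the series `₂F₁(α, β; γ; 1)`. -/
def gaussTerm (α β γ : ℝ) (n : ℕ) : ℝ :=
  (n.factorial : ℝ)⁻¹ * poch α n * poch β n * (poch γ n)⁻¹

lemma gaussTerm_zero (α β γ : ℝ) : gaussTerm α β γ 0 = 1 := by simp [gaussTerm, poch]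

lemma gaussTerm_succ {γ : ℝ} (hγ : 0 < γ) (α β : ℝ) (n : ℕ) :
    ((n : ℝ) + 1) * (γ + n) * gaussTerm α β γ (n + 1) =
      (α + n) * (β + n) * gaussTerm α β γ n := by
  have h1 := (poch_pos hγ n).ne'
  have h2 : γ + n ≠ 0 := by positivity
  have h3 : (n.factorial : ℝ) ≠ 0 := by positivity
  simp only [gaussTerm, poch_succ, Nat.factorial_succ]
  push_cast
  field_simp

lemma gaussTerm_add_one {γ : ℝ} (hγ : 0 < γ) (α β : ℝ) (n : ℕ) :
    (γ + n) * gaussTerm α β (γ + 1) n = γ * gaussTerm α β γ n := by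
  have h1 := (poch_pos hγ n).ne'
  have h4 := (poch_pos (by linarith : 0 < γ + 1) n).ne'
  have h5 := poch_add_one_left γ n
  simp only [gaussTerm]
  have : (γ + n) * (poch (γ + 1) n)⁻¹ = γ * (poch γ n)⁻¹ := by
    field_simp
    linarith
  linear_combination ((n.factorial : ℝ)⁻¹ * poch α n * poch β n) * this

/-- Three Euler limits combined; the factor `n + 1` reduces (n + 1)! to n!. The limit may be 0, so
it serves only for upper bounds. -/
lemma tendsto_mul_gaussTerm {γ : ℝ} (hγ : 0 < γ) (α β : ℝ) :
    Tendsto (fun n : ℕ => ((n : ℝ) + 1) * gaussTerm α β γ (n + 1) / (n : ℝ) ^ (α + β - γ)) atTop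
      (𝓝 ((Real.Gamma α)⁻¹ * (Real.Gamma β)⁻¹ / (Real.Gamma γ)⁻¹)) := by
  refine (((tendsto_poch_div α).mul (tendsto_poch_div β)).div (tendsto_poch_div γ)
    (inv_ne_zero (Real.Gamma_pos_of_pos hγ).ne')).congr' ?_
  filter_upwards [eventually_gt_atTop 0] with n hn
  have hn' : (0 : ℝ) < n := by exact_mod_cast hn
  have h1 := (poch_pos hγ (n + 1)).ne'
  have h3 : (n.factorial : ℝ) ≠ 0 := by positivity
  have ha := (Real.rpow_pos_of_pos hn' α).ne'
  have hb := (Real.rpow_pos_of_pos hn' β).ne'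
  have hc := (Real.rpow_pos_of_pos hn' γ).ne'
  rw [Real.rpow_sub hn', Real.rpow_add hn', gaussTerm, Nat.factorial_succ]
  push_cast
  simp only [Pi.div_apply]
  field_simp

lemma summable_gaussTerm {α β γ : ℝ} (hγ : 0 < γ) (h : 0 < γ - α - β) :
    Summable (gaussTerm α β γ) := by
  rw [← summable_nat_add_iff 1]
  have hO := (tendsto_mul_gaussTerm hγ α β).isBigO_one ℝ
  refine summable_of_isBigO_nat (Real.summable_nat_rpow.2 (by linarith : α + β - γ - 1 < -1)) ?_
  obtain ⟨K, hK⟩ := hO.bound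
  refine Asymptotics.IsBigO.of_bound K ?_
  filter_upwards [hK, eventually_gt_atTop 0] with n hn hn0
  have hn' : (0 : ℝ) < n := by exact_mod_cast hn0
  have hp := Real.rpow_pos_of_pos hn' (α + β - γ)
  rw [norm_div, norm_mul, norm_one, mul_one, Real.norm_of_nonneg hp.le, div_le_iff₀ hp,
    Real.norm_of_nonneg (by positivity : (0 : ℝ) ≤ n + 1)] at hn
  rw [Real.rpow_sub_one hn'.ne', norm_div, Real.norm_of_nonneg hp.le, Real.norm_of_nonneg hn'.le,
    ← mul_div_assoc, le_div_iff₀ hn']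
  refine le_trans ?_ hn
  rw [mul_comm]
  exact mul_le_mul_of_nonneg_right (by linarith) (norm_nonneg _)

lemma tendsto_nat_mul_gaussTerm {α β γ : ℝ} (hγ : 0 < γ) (h : 0 < γ - α - β) :
    Tendsto (fun n : ℕ => (n : ℝ) * gaussTerm α β γ n) atTop (𝓝 0) := by
  rw [← tendsto_add_atTop_iff_nat 1]
  have h1 : Tendsto (fun n : ℕ => (n : ℝ) ^ (α + β - γ)) atTop (𝓝 0) := by
    have := (tendsto_rpow_neg_atTop h).comp tendsto_natCast_atTop_atTop
    refine this.congr fun n => ?_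
    simp only [Function.comp_apply]
    congr 1
    ring
  have h2 := (tendsto_mul_gaussTerm hγ α β).mul h1
  rw [mul_zero] at h2
  refine h2.congr' ?_
  filter_upwards [eventually_gt_atTop 0] with n hn
  have hn' : (0 : ℝ) < n := by exact_mod_cast hn
  rw [div_mul_cancel₀ _ (Real.rpow_pos_of_pos hn' _).ne']
  push_cast
  rfl

/-- The contiguous relation for `₂F₁(α, β; γ; 1)` in the lower parameter. -/
lemma tsum_gaussTerm_add_one {α β γ : ℝ} (hγ : 0 < γ) (h : 0 < γ - α - β) :
    γ * (γ - α - β) * ∑' n, gaussTerm α β γ n =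
      (γ - α) * (γ - β) * ∑' n, gaussTerm α β (γ + 1) n := by
  have hs := summable_gaussTerm hγ h
  have hs1 := summable_gaussTerm (by linarith : 0 < γ + 1) (by linarith : 0 < γ + 1 - α - β)
  -- Termwise, the two sides differ by a telescoping difference of γ n tₙ, where tₙ is the `n`-th
  -- term, and n tₙ → 0.
  have hG : ∀ n : ℕ, γ * (γ - α - β) * gaussTerm α β γ n -
      (γ - α) * (γ - β) * gaussTerm α β (γ + 1) n =
      γ * (n * gaussTerm α β γ n) - γ * (((n + 1 : ℕ) : ℝ) * gaussTerm α β γ (n + 1)) := by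
    intro n
    have h1 := gaussTerm_succ hγ α β n
    have h2 := gaussTerm_add_one hγ α β n
    have h3 : γ + n ≠ 0 := by positivity
    refine mul_left_cancel₀ h3 ?_
    push_cast
    linear_combination (-(γ - α) * (γ - β)) * h2 + γ * h1
  have hsum := (hs.hasSum.mul_left (γ * (γ - α - β))).sub
    (hs1.hasSum.mul_left ((γ - α) * (γ - β)))
  have h1 := hsum.tendsto_sum_nat
  simp only [hG] at h1
  have h2 : Tendsto (fun n : ℕ => γ * (((0 : ℕ) : ℝ) * gaussTerm α β γ 0) -
      γ * (n * gaussTerm α β γ n)) atTop (𝓝 (γ * (((0 : ℕ) : ℝ) * gaussTerm α β γ 0) - γ * 0)) :=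
    tendsto_const_nhds.sub ((tendsto_nat_mul_gaussTerm hγ h).const_mul γ)
  have h3 := tendsto_nhds_unique h1 (h2.congr fun n =>
    (sum_range_sub' (fun n : ℕ => γ * (n * gaussTerm α β γ n)) n).symm)
  simp only [Nat.cast_zero, zero_mul, mul_zero, sub_self] at h3
  linarith

lemma tsum_gaussTerm_add_nat {α β γ : ℝ} (hγ : 0 < γ) (h : 0 < γ - α - β) (N : ℕ) :
    poch γ N * poch (γ - α - β) N * ∑' n, gaussTerm α β γ n =
      poch (γ - α) N * poch (γ - β) N * ∑' n, gaussTerm α β (γ + N) n := by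
  induction N with
  | zero => simp [poch]
  | succ N ih =>
    have h1 := tsum_gaussTerm_add_one (α := α) (β := β) (by positivity : 0 < γ + N)
      (by linarith [(Nat.cast_nonneg N : (0 : ℝ) ≤ N)])
    have h2 : γ + ((N + 1 : ℕ) : ℝ) = γ + N + 1 := by push_cast; ring
    simp only [poch_succ, h2]
    linear_combination (γ + N) * (γ - α - β + N) * ih + (poch (γ - α) N * poch (γ - β) N) * h1

/-- As the lower parameter grows only the term `n = 0` survives; the series at `N = 0` dominates
because (γ)_n ≤ (γ + N)_n. -/
lemma tendsto_tsum_gaussTerm {α β γ : ℝ} (hγ : 0 < γ) (h : 0 < γ - α - β) :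
    Tendsto (fun N : ℕ => ∑' n, gaussTerm α β (γ + N) n) atTop (𝓝 1) := by
  have h1 : (1 : ℝ) = ∑' n : ℕ, if n = 0 then 1 else 0 := by rw [tsum_ite_eq]
  rw [h1]
  refine tendsto_tsum_of_dominated_convergence (summable_gaussTerm hγ h).norm (fun n => ?_)
    (Eventually.of_forall fun N n => ?_)
  · rcases n with _ | n
    · simp [gaussTerm_zero]
    · simp only [Nat.add_eq_zero_iff, one_ne_zero, and_false, if_false, gaussTerm]
      rw [← mul_zero ((((n + 1).factorial : ℝ))⁻¹ * poch α (n + 1) * poch β (n + 1))]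
      refine Tendsto.const_mul _ (Tendsto.inv_tendsto_atTop ?_)
      refine tendsto_atTop_mono (f := fun N : ℕ => (N : ℝ) * poch γ n) (fun N => ?_)
        (tendsto_natCast_atTop_atTop.atTop_mul_const (poch_pos hγ n))
      rw [poch_succ, mul_comm]
      have : poch γ n ≤ poch (γ + N) n := by
        rw [poch_eq_prod, poch_eq_prod]
        exact prod_le_prod (fun _ _ => by positivity)
          fun _ _ => by linarith [(Nat.cast_nonneg N : (0 : ℝ) ≤ N)]
      refine mul_le_mul this ?_ (by positivity) (poch_pos (by positivity) n).le
      linarith [(Nat.cast_nonneg n : (0 : ℝ) ≤ n)]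
  · have : poch γ n ≤ poch (γ + N) n := by
      rw [poch_eq_prod, poch_eq_prod]
      exact prod_le_prod (fun _ _ => by positivity)
        fun _ _ => by linarith [(Nat.cast_nonneg N : (0 : ℝ) ≤ N)]
    have hp := poch_pos hγ n
    have hp' := poch_pos (by positivity : 0 < γ + N) n
    rw [gaussTerm, gaussTerm, norm_mul, norm_mul _ (poch γ n)⁻¹, norm_inv, norm_inv,
      Real.norm_of_nonneg hp.le, Real.norm_of_nonneg hp'.le]
    gcongr

/-- Gauss's summation theorem. -/
theorem tsum_gaussTerm {α β γ : ℝ} (hγ : 0 < γ) (h : 0 < γ - α - β)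
    (hα : 0 < γ - α) (hβ : 0 < γ - β) :
    ∑' n, gaussTerm α β γ n = Real.Gamma γ * Real.Gamma (γ - α - β) /
      (Real.Gamma (γ - α) * Real.Gamma (γ - β)) := by
  -- Let N → ∞ in the iterated contiguous relation. Euler's normalizations agree on both sides
  -- because γ + (γ - α - β) = (γ - α) + (γ - β).
  have h1 := ((tendsto_poch_div γ).mul (tendsto_poch_div (γ - α - β))).mul_const
    (∑' n, gaussTerm α β γ n)
  have h2 := ((tendsto_poch_div (γ - α)).mul (tendsto_poch_div (γ - β))).mul
    ((tendsto_tsum_gaussTerm hγ h).comp (tendsto_add_atTop_nat 1))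
  have h3 := tendsto_nhds_unique_of_eventuallyEq h1 h2 ?_
  · have g1 := (Real.Gamma_pos_of_pos hγ).ne'
    have g2 := (Real.Gamma_pos_of_pos h).ne'
    have g3 := (Real.Gamma_pos_of_pos hα).ne'
    have g4 := (Real.Gamma_pos_of_pos hβ).ne'
    field_simp at h3 ⊢
    linarith
  · filter_upwards [eventually_gt_atTop 0] with n hn
    have hn' : (0 : ℝ) < n := by exact_mod_cast hn
    have h4 := tsum_gaussTerm_add_nat hγ h (n + 1)
    have h5 : (n : ℝ) ^ γ * (n : ℝ) ^ (γ - α - β) = (n : ℝ) ^ (γ - α) * (n : ℝ) ^ (γ - β) := by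
      rw [← Real.rpow_add hn', ← Real.rpow_add hn']
      congr 1
      ring
    simp only [Function.comp_apply]
    rw [div_mul_div_comm, div_mul_div_comm, div_mul_eq_mul_div, div_mul_eq_mul_div, h4]
    congr 1
    linear_combination (n.factorial : ℝ) ^ 2 * h5

/-! ### Beta integrals of hypergeometric functions -/

lemma setIntegral_beta {u v : ℝ} (hu : 0 < u) (hv : 0 < v) :
    ∫ x in Set.Ioo (0 : ℝ) 1, x ^ (u - 1) * (1 - x) ^ (v - 1) =
      Real.Gamma u * Real.Gamma v / Real.Gamma (u + v) := by
  have h := ProbabilityTheory.beta_eq_betaIntegralReal u v hu hv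
  rw [ProbabilityTheory.beta] at h
  rw [h, Complex.betaIntegral, intervalIntegral.integral_of_le (by norm_num),
    ← integral_Ioc_eq_integral_Ioo, ← RCLike.re_to_complex, ← integral_re]
  · refine setIntegral_congr_fun measurableSet_Ioc fun x ⟨hx1, hx2⟩ => ?_
    norm_cast
    rw [← Complex.ofReal_cpow, ← Complex.ofReal_cpow, RCLike.re_to_complex,
      Complex.re_mul_ofReal, Complex.ofReal_re]
    all_goals linarith
  · have := Complex.betaIntegral_convergent (u := u) (v := v) (by simpa) (by simpa)
    rwa [intervalIntegrable_iff_integrableOn_Ioc_of_le (by simp), IntegrableOn] at this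

/-- Otherwise the integral would have the default value 0, but the beta value is positive. -/
lemma integrableOn_beta {u v : ℝ} (hu : 0 < u) (hv : 0 < v) :
    Integrable (fun x : ℝ => x ^ (u - 1) * (1 - x) ^ (v - 1))
      (volume.restrict (Set.Ioo (0 : ℝ) 1)) := by
  by_contra h
  have h1 := setIntegral_beta hu hv
  rw [integral_undef h] at h1
  have := Real.Gamma_pos_of_pos hu
  have := Real.Gamma_pos_of_pos hv
  have := Real.Gamma_pos_of_pos (add_pos hu hv)
  have : 0 < Real.Gamma u * Real.Gamma v / Real.Gamma (u + v) := by positivity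
  linarith

/-- The Mellin transform of `(1 - x) ^ (γ - 1) * ₂F₁(α, β; γ; 1 - x)` on `[0, 1]`. -/
lemma setIntegral_hypergeometric {u γ α β : ℝ} (hu : 0 < u) (hγ : 0 < γ)
    (h : 0 < u + γ - α - β) (hα : 0 < u + γ - α) (hβ : 0 < u + γ - β) :
    ∫ x in Set.Ioo (0 : ℝ) 1, x ^ (u - 1) * (1 - x) ^ (γ - 1) * ₂F₁ α β γ (1 - x) =
      Real.Gamma u * Real.Gamma γ * Real.Gamma (u + γ - α - β) /
        (Real.Gamma (u + γ - α) * Real.Gamma (u + γ - β)) := by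
  have huγ : 0 < u + γ := add_pos hu hγ
  have gu := Real.Gamma_pos_of_pos hu
  have gγ := Real.Gamma_pos_of_pos hγ
  have guγ := Real.Gamma_pos_of_pos huγ
  set F : ℕ → ℝ → ℝ := fun n x =>
    gaussTerm α β γ n * (x ^ (u - 1) * (1 - x) ^ (γ + n - 1)) with hF
  have hval : ∀ n : ℕ, ∫ x in Set.Ioo (0 : ℝ) 1, x ^ (u - 1) * (1 - x) ^ (γ + n - 1) =
      Real.Gamma u * Real.Gamma γ / Real.Gamma (u + γ) * (poch γ n / poch (u + γ) n) := by
    intro n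
    rw [setIntegral_beta hu (by positivity), ← add_assoc, Gamma_add_nat hγ, Gamma_add_nat huγ]
    have := poch_pos huγ n
    field_simp
  -- Integrating against the beta density replaces the lower parameter γ by u + γ and leaves a
  -- series at argument 1.
  have hcoef : ∀ n : ℕ, gaussTerm α β γ n * (poch γ n / poch (u + γ) n) =
      gaussTerm α β (u + γ) n := by
    intro n
    have := poch_pos hγ n
    simp only [gaussTerm]
    field_simp
  have hint : ∀ n, Integrable (F n) (volume.restrict (Set.Ioo (0 : ℝ) 1)) := fun n =>
    (integrableOn_beta hu (by positivity)).const_mul _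
  have hnorm : ∀ n, ∫ x in Set.Ioo (0 : ℝ) 1, ‖F n x‖ =
      Real.Gamma u * Real.Gamma γ / Real.Gamma (u + γ) * ‖gaussTerm α β (u + γ) n‖ := by
    intro n
    have h0 : ∀ x ∈ Set.Ioo (0 : ℝ) 1, ‖F n x‖ =
        ‖gaussTerm α β γ n‖ * (x ^ (u - 1) * (1 - x) ^ (γ + n - 1)) := by
      intro x hx
      have h1 := Real.rpow_nonneg hx.1.le (u - 1)
      have h2 := Real.rpow_nonneg (sub_pos.2 hx.2).le (γ + n - 1)
      rw [hF, norm_mul, Real.norm_of_nonneg (mul_nonneg h1 h2)]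
    rw [setIntegral_congr_fun measurableSet_Ioo h0, integral_const_mul, hval, ← hcoef, norm_mul,
      Real.norm_of_nonneg (div_pos (poch_pos hγ n) (poch_pos huγ n)).le]
    ring
  have hsum := hasSum_integral_of_summable_integral_norm hint
    (by simpa only [hnorm] using (summable_gaussTerm huγ h).norm.mul_left _)
  have hcongr : ∀ x ∈ Set.Ioo (0 : ℝ) 1, ∑' n, F n x =
      x ^ (u - 1) * (1 - x) ^ (γ - 1) * ₂F₁ α β γ (1 - x) := by
    intro x hx
    have h1 : 0 < 1 - x := sub_pos.2 hx.2
    rw [ordinaryHypergeometric_eq_tsum]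
    simp only [← tsum_mul_left]
    refine tsum_congr fun n => ?_
    rw [hF]
    simp only [gaussTerm, smul_eq_mul]
    rw [show γ + n - 1 = γ - 1 + n by ring, Real.rpow_add h1, Real.rpow_natCast]
    ring
  rw [setIntegral_congr_fun measurableSet_Ioo hcongr] at hsum
  rw [← hsum.tsum_eq]
  have : ∀ n, ∫ x in Set.Ioo (0 : ℝ) 1, F n x =
      Real.Gamma u * Real.Gamma γ / Real.Gamma (u + γ) * gaussTerm α β (u + γ) n := by
    intro n
    rw [hF, integral_const_mul, hval, ← hcoef]
    ring
  simp only [this, tsum_mul_left]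
  rw [tsum_gaussTerm huγ h hα hβ]
  field_simp

/-! ### The moments -/

/-- The sequence `u, v, u + 1, v + 1, u + 2, …`. -/
def interlace (u v : ℝ) (i : ℕ) : ℝ := (if Even i then u else v) + (i / 2 : ℕ)

lemma interlace_two_mul (u v : ℝ) (k : ℕ) : interlace u v (2 * k) = u + k := by
  simp [interlace]

lemma interlace_two_mul_add_one (u v : ℝ) (k : ℕ) : interlace u v (2 * k + 1) = v + k := by
  have : ¬ Even (2 * k + 1) := by simp
  rw [interlace, if_neg this, show (2 * k + 1) / 2 = k by omega]

lemma interlace_add_two (u v : ℝ) (i : ℕ) : interlace u v (i + 2) = interlace u v i + 1 := by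
  have : Even (i + 2) ↔ Even i := by simp [Nat.even_add]
  rw [interlace, interlace, show (i + 2) / 2 = i / 2 + 1 by omega]
  simp only [this]
  push_cast
  ring

lemma interlace_lt {u v w : ℝ} (hu : w < u) (hv : w < v) (i : ℕ) : w < interlace u v i := by
  rw [interlace]
  have : (0 : ℝ) ≤ (i / 2 : ℕ) := Nat.cast_nonneg _
  split_ifs <;> linarith

/-- The `s`-th moment of the first weight. -/
def momentSeq (a b c d : ℝ) (s : ℕ) : ℝ := poch a s * poch b s / (poch c s * poch d s)

lemma momentSeq_succ (a b c d : ℝ) (s : ℕ) : momentSeq a b c d (s + 1) =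
    momentSeq a b c d s * ((a + s) * (b + s) / ((c + s) * (d + s))) := by
  simp only [momentSeq, poch_succ]
  rw [div_mul_div_comm]
  congr 1 <;> ring

lemma momentSeq_pos {a b c d : ℝ} (ha : 0 < a) (hb : 0 < b) (hc : 0 < c) (hd : 0 < d) (s : ℕ) :
    0 < momentSeq a b c d s :=
  div_pos (mul_pos (poch_pos ha s) (poch_pos hb s)) (mul_pos (poch_pos hc s) (poch_pos hd s))

lemma integral_mu {a b c d : ℝ} (ha : 0 < a) (hb : 0 < b) (hc : 0 < c) (hd : 0 < d)
    (hδ : 0 < delta a b c d) (φ : ℝ → ℝ) : ∫ x, φ x ∂(mu a b c d) =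
      Real.Gamma c * Real.Gamma d / (Real.Gamma a * Real.Gamma b * Real.Gamma (delta a b c d)) *
        ∫ x in Set.Ioo (0 : ℝ) 1, x ^ (a - 1) * (1 - x) ^ (delta a b c d - 1) * φ x := by
  have ga := Real.Gamma_pos_of_pos ha
  have gb := Real.Gamma_pos_of_pos hb
  have gc := Real.Gamma_pos_of_pos hc
  have gd := Real.Gamma_pos_of_pos hd
  have gδ := Real.Gamma_pos_of_pos hδ
  rw [mu, integral_withDensity_eq_integral_toReal_smul (by fun_prop)
    (Eventually.of_forall fun _ => ENNReal.ofReal_lt_top), ← integral_const_mul,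
    Measure.restrict_congr_set Ioo_ae_eq_Icc.symm]
  refine setIntegral_congr_fun measurableSet_Ioo fun x hx => ?_
  have h1 := Real.rpow_nonneg hx.1.le (a - 1)
  have h2 := Real.rpow_nonneg (sub_pos.2 hx.2).le (delta a b c d - 1)
  simp only [smul_eq_mul]
  rw [ENNReal.toReal_ofReal (by positivity)]
  ring

lemma integral_pow_mul_hypergeometric {a b c d α β : ℝ} (ha : 0 < a) (hb : 0 < b) (hc : 0 < c)
    (hd : 0 < d) (hδ : 0 < delta a b c d) (s : ℕ)
    (h : 0 < a + s + delta a b c d - α - β) (hα : 0 < a + s + delta a b c d - α)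
    (hβ : 0 < a + s + delta a b c d - β) :
    ∫ x, x ^ s * ₂F₁ α β (delta a b c d) (1 - x) ∂(mu a b c d) =
      Real.Gamma c * Real.Gamma d / (Real.Gamma a * Real.Gamma b) * (Real.Gamma (a + s) *
        Real.Gamma (a + s + delta a b c d - α - β) /
        (Real.Gamma (a + s + delta a b c d - α) * Real.Gamma (a + s + delta a b c d - β))) := by
  have has : 0 < a + s := by positivity
  rw [integral_mu ha hb hc hd hδ]
  have : ∀ x ∈ Set.Ioo (0 : ℝ) 1, x ^ (a - 1) * (1 - x) ^ (delta a b c d - 1) *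
      (x ^ s * ₂F₁ α β (delta a b c d) (1 - x)) =
      x ^ (a + s - 1) * (1 - x) ^ (delta a b c d - 1) * ₂F₁ α β (delta a b c d) (1 - x) := by
    intro x hx
    rw [show a + s - 1 = a - 1 + s by ring, Real.rpow_add hx.1, Real.rpow_natCast]
    ring
  rw [setIntegral_congr_fun measurableSet_Ioo this, setIntegral_hypergeometric has hδ h hα hβ]
  have ga := (Real.Gamma_pos_of_pos ha).ne'
  have gb := (Real.Gamma_pos_of_pos hb).ne'
  have gδ := (Real.Gamma_pos_of_pos hδ).ne'
  have g1 := (Real.Gamma_pos_of_pos hα).ne'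
  have g2 := (Real.Gamma_pos_of_pos hβ).ne'
  field_simp

/-- The parameters of w₁ turn the Gamma arguments into a + s, b + s, c + s, d + s. -/
lemma integral_pow_mul_w₁ {a b c d : ℝ} (ha : 0 < a) (hb : 0 < b) (hc : 0 < c) (hd : 0 < d)
    (hδ : 0 < delta a b c d) (s : ℕ) :
    ∫ x, x ^ s * w₁ a b c d x ∂(mu a b c d) = momentSeq a b c d s := by
  have e1 : a + s + delta a b c d - (c - b) - (d - b) = b + s := by rw [delta]; ring
  have e2 : a + s + delta a b c d - (c - b) = d + s := by rw [delta]; ring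
  have e3 : a + s + delta a b c d - (d - b) = c + s := by rw [delta]; ring
  have h := integral_pow_mul_hypergeometric (α := c - b) (β := d - b) ha hb hc hd hδ s
    (by rw [e1]; positivity) (by rw [e2]; positivity) (by rw [e3]; positivity)
  rw [e1, e2, e3, Gamma_add_nat ha, Gamma_add_nat hb, Gamma_add_nat hc, Gamma_add_nat hd] at h
  simp only [w₁]
  rw [h, momentSeq]
  have ga := (Real.Gamma_pos_of_pos ha).ne'
  have gb := (Real.Gamma_pos_of_pos hb).ne'
  have gc := (Real.Gamma_pos_of_pos hc).ne'
  have gd := (Real.Gamma_pos_of_pos hd).ne'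
  have pc := (poch_pos hc s).ne'
  have pd := (poch_pos hd s).ne'
  field_simp

/-- Lowering the parameter d - b by 1 raises the arguments b + s and c + s by 1, whence the extra
factor. -/
lemma integral_pow_mul_w₂ {a b c d : ℝ} (ha : 0 < a) (hb : 0 < b) (hc : 0 < c) (hd : 0 < d)
    (hδ : 0 < delta a b c d) (s : ℕ) :
    ∫ x, x ^ s * w₂ a b c d x ∂(mu a b c d) =
      momentSeq a b c d s * (c / b * ((b + s) / (c + s))) := by
  have e1 : a + s + delta a b c d - (c - b) - (d - b - 1) = b + (s + 1 : ℕ) := by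
    rw [delta]; push_cast; ring
  have e2 : a + s + delta a b c d - (c - b) = d + s := by rw [delta]; ring
  have e3 : a + s + delta a b c d - (d - b - 1) = c + (s + 1 : ℕ) := by
    rw [delta]; push_cast; ring
  have h := integral_pow_mul_hypergeometric (α := c - b) (β := d - b - 1) ha hb hc hd hδ s
    (by rw [e1]; positivity) (by rw [e2]; positivity) (by rw [e3]; positivity)
  rw [e1, e2, e3, Gamma_add_nat ha, Gamma_add_nat hb, Gamma_add_nat hc, Gamma_add_nat hd] at h
  simp only [w₂, mul_left_comm _ (c / b)]
  rw [integral_const_mul, h, momentSeq, poch_succ, poch_succ]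
  have ga := (Real.Gamma_pos_of_pos ha).ne'
  have gb := (Real.Gamma_pos_of_pos hb).ne'
  have gc := (Real.Gamma_pos_of_pos hc).ne'
  have gd := (Real.Gamma_pos_of_pos hd).ne'
  have pc := (poch_pos hc s).ne'
  have pd := (poch_pos hd s).ne'
  have : c + s ≠ 0 := by positivity
  field_simp

lemma momentSeq_add {a b c d : ℝ} (i k : ℕ) :
    momentSeq a b c d (i + k) = momentSeq a b c d i *
      ∏ t ∈ range (2 * k), (i + interlace b a t) / (i + interlace c d t) := by
  induction k with
  | zero => simp
  | succ k ih =>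
    rw [← add_assoc, momentSeq_succ, ih, show 2 * (k + 1) = 2 * k + 1 + 1 by ring,
      prod_range_succ, prod_range_succ]
    simp only [interlace_two_mul, interlace_two_mul_add_one]
    rw [mul_assoc, mul_assoc, div_mul_div_comm]
    push_cast
    congr 3 <;> ring

/-- The moment matrix in closed form. -/
lemma moment_eq {a b c d : ℝ} (ha : 0 < a) (hb : 0 < b) (hc : 0 < c) (hd : 0 < d)
    (hδ : 0 < delta a b c d) (i j : ℕ) : moment a b c d i j = momentSeq a b c d i *
      ((if Even j then 1 else c / b) *
        ∏ t ∈ range j, (i + interlace b a t) / (i + interlace c d t)) := by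
  rcases Nat.even_or_odd' j with ⟨k, rfl | rfl⟩
  · have h0 : Even (2 * k) := by simp
    simp only [moment, xi, if_pos h0, one_mul]
    rw [← momentSeq_add, ← integral_pow_mul_w₁ ha hb hc hd hδ]
    congr 1
    funext x
    rw [Nat.mul_div_cancel_left k (by norm_num), pow_add]
    ring
  · have h0 : ¬ Even (2 * k + 1) := by simp
    simp only [moment, xi, if_neg h0]
    rw [prod_range_succ, interlace_two_mul, interlace_two_mul]
    have h1 := integral_pow_mul_w₂ ha hb hc hd hδ (i + k)
    rw [momentSeq_add] at h1
    calc _ = ∫ x, x ^ (i + k) * w₂ a b c d x ∂(mu a b c d) := by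
          congr 1
          funext x
          rw [show (2 * k + 1) / 2 = k by omega, pow_add]
          ring
      _ = _ := by
          rw [h1]
          push_cast
          rw [show b + ((i : ℝ) + k) = i + (b + k) by ring,
            show c + ((i : ℝ) + k) = i + (c + k) by ring]
          ring

/-! ### Rational functions with prescribed poles -/

section Rational

variable {e f : ℕ → ℝ}

/-- The rational function `s (s - 1) ⋯ (s - n + 1) / ((s + e₀) ⋯ (s + eₙ₋₁))`. -/
def ratFun (e : ℕ → ℝ) (n : ℕ) (s : ℝ) : ℝ := ∏ i ∈ range n, (s - i) / (s + e i)

lemma ratFun_zero (e : ℕ → ℝ) (s : ℝ) : ratFun e 0 s = 1 := by simp [ratFun]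

lemma ratFun_succ (e : ℕ → ℝ) (n : ℕ) (s : ℝ) :
    ratFun e (n + 1) s = ratFun e n s * ((s - n) / (s + e n)) := prod_range_succ _ _

lemma ratFun_eq_zero (e : ℕ → ℝ) {n s : ℕ} (h : s < n) : ratFun e n s = 0 :=
  prod_eq_zero (i := s) (by simpa using h) (by simp)

lemma ratFun_self_pos (he : ∀ i, 0 < e i) (n : ℕ) : 0 < ratFun e n n := by
  refine prod_pos fun i hi => div_pos ?_ (add_pos_of_nonneg_of_pos n.cast_nonneg (he i))
  have : (i : ℝ) < n := by exact_mod_cast mem_range.1 hi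
  linarith

lemma tendsto_ratFun (e : ℕ → ℝ) (n : ℕ) : Tendsto (ratFun e n) atTop (𝓝 1) := by
  rw [← prod_const_one (s := range n)]
  refine tendsto_finsetProd _ fun i _ => ?_
  have h1 : Tendsto (fun s : ℝ => s + e i) atTop atTop := tendsto_atTop_add_const_right _ _ tendsto_id
  have h2 : Tendsto (fun s : ℝ => 1 - (i + e i) / (s + e i)) atTop (𝓝 (1 - 0)) :=
    tendsto_const_nhds.sub (h1.const_div_atTop _)
  rw [sub_zero] at h2
  refine h2.congr' ?_
  filter_upwards [h1.eventually_gt_atTop 0] with s hs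
  field_simp
  ring

open Polynomial in
lemma monic_prod_X_add_C (g : ℕ → ℝ) (n : ℕ) : (∏ t ∈ range n, (X + C (g t))).Monic :=
  monic_prod_of_monic _ _ fun _ _ => monic_X_add_C _

open Polynomial in
lemma natDegree_prod_X_add_C (g : ℕ → ℝ) (n : ℕ) :
    (∏ t ∈ range n, (X + C (g t))).natDegree = n := by
  rw [natDegree_prod_of_monic _ _ fun _ _ => monic_X_add_C _]
  simp

open Polynomial in
lemma prod_X_add_C_sub_mem (g h : ℕ → ℝ) (n : ℕ) :
    ∏ t ∈ range n, (X + C (g t)) - ∏ t ∈ range n, (X + C (h t)) ∈ degreeLT ℝ n := by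
  rw [mem_degreeLT]
  have hd : ∀ g : ℕ → ℝ, (∏ t ∈ range n, (X + C (g t))).degree = (n : WithBot ℕ) := fun g => by
    rw [degree_eq_natDegree (monic_prod_X_add_C g n).ne_zero, natDegree_prod_X_add_C]
  rw [← hd g]
  refine degree_sub_lt_left ((hd g).trans (hd h).symm) (monic_prod_X_add_C g n).ne_zero ?_
  rw [(monic_prod_X_add_C g n).leadingCoeff, (monic_prod_X_add_C h n).leadingCoeff]

/-- Puts the products of different lengths `j ≤ n` over one denominator. -/
lemma prod_ite_div (he : ∀ i, 0 < e i) {j n s : ℕ} (h : j ≤ n) :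
    (∏ t ∈ range n, ((s : ℝ) + if t < j then f t else e t)) / ∏ t ∈ range n, ((s : ℝ) + e t) =
      ∏ t ∈ range j, (s + f t) / (s + e t) := by
  rw [← prod_div_distrib]
  have : ∀ t ∈ range j, ((s : ℝ) + f t) / (s + e t) =
      (s + if t < j then f t else e t) / (s + e t) := fun t ht => by
    rw [if_pos (mem_range.1 ht)]
  rw [prod_congr rfl this]
  refine (prod_subset (range_mono h) fun t _ ht => ?_).symm
  rw [if_neg (by simpa using ht), div_self]
  have := he t
  positivity

open Polynomial in
/-- A rational function of the span of `∏ (s + fₜ) / (s + eₜ)` that vanishes at `0, …, n - 1` is a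
multiple of `ratFun e n`. -/
lemma sum_prod_div_eq_ratFun (he : ∀ i, 0 < e i) (w : ℕ → ℝ) (n : ℕ)
    (h : ∀ i < n, ∑ j ∈ range (n + 1), w j *
      ∏ t ∈ range j, ((i : ℝ) + f t) / (i + e t) = 0) (s : ℕ) :
    ∑ j ∈ range (n + 1), w j * ∏ t ∈ range j, ((s : ℝ) + f t) / (s + e t) =
      (∑ j ∈ range (n + 1), w j) * ratFun e n s := by
  -- Over the common denominator, `N` is the numerator of the difference of the two sides. Each `M
  -- j` and `Z` is monic of degree `n`, so `N` has degree below `n`; having the `n` roots 0, …, n -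
  -- 1, it vanishes.
  set M : ℕ → ℝ[X] := fun j => ∏ t ∈ range n, (X + C (if t < j then f t else e t)) with hM
  set Z : ℝ[X] := ∏ t ∈ range n, (X + C (-(t : ℝ))) with hZ
  set N : ℝ[X] := ∑ j ∈ range (n + 1), w j • (M j - Z) with hN
  have hdeg : N ∈ degreeLT ℝ n :=
    Submodule.sum_mem _ fun j _ => Submodule.smul_mem _ _ (prod_X_add_C_sub_mem _ _ n)
  have hMe : ∀ (j s : ℕ), (M j).eval (s : ℝ) =
      ∏ t ∈ range n, ((s : ℝ) + if t < j then f t else e t) := fun j s => by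
    rw [hM, eval_prod]; simp
  have hZe : ∀ s : ℕ, Z.eval (s : ℝ) = ∏ t ∈ range n, ((s : ℝ) - t) := fun s => by
    rw [hZ, eval_prod]; simp [sub_eq_add_neg]
  have hD : ∀ s : ℕ, ∏ t ∈ range n, ((s : ℝ) + e t) ≠ 0 := fun s =>
    (prod_pos fun t _ => by have := he t; positivity).ne'
  have hNe : ∀ s : ℕ, N.eval (s : ℝ) / ∏ t ∈ range n, ((s : ℝ) + e t) =
      ∑ j ∈ range (n + 1), w j * ∏ t ∈ range j, ((s : ℝ) + f t) / (s + e t) -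
      (∑ j ∈ range (n + 1), w j) * ratFun e n s := by
    intro s
    rw [hN, eval_finsetSum, sum_div, sum_mul, ← sum_sub_distrib]
    refine sum_congr rfl fun j hj => ?_
    rw [eval_smul, eval_sub, smul_eq_mul, mul_div_assoc, sub_div, hMe, hZe,
      prod_ite_div he (by simpa [Nat.lt_succ_iff] using hj), ratFun,
        ← prod_div_distrib, mul_sub]
  have h0 : N = 0 := by
    refine eq_zero_of_degree_lt_of_eval_index_eq_zero (s := range n) (v := fun i : ℕ => (i : ℝ))
      Nat.cast_injective.injOn (by simpa [mem_degreeLT] using hdeg) fun i hi => ?_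
    have h1 := hNe i
    rw [h i (mem_range.1 hi), ratFun_eq_zero e (mem_range.1 hi), mul_zero, sub_zero,
      div_eq_zero_iff] at h1
    exact h1.resolve_right (hD i)
  have h2 := hNe s
  rw [h0, eval_zero, zero_div] at h2
  linarith

open Polynomial in
/-- Partial fractions with respect to the functions `ratFun e k`. -/
lemma exists_sum_ratFun (he : ∀ i, 0 < e i) (n : ℕ) (N : ℝ[X]) (hN : N.natDegree ≤ n) :
    ∃ u : ℕ → ℝ, (∀ s : ℕ, N.eval (s : ℝ) / ∏ t ∈ range n, ((s : ℝ) + e t) =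
      ∑ k ∈ range (n + 1), u k * ratFun e k s) ∧
      (N.eval (-(e (n - 1))) ≠ 0 → u n ≠ 0) := by
  induction n generalizing N with
  | zero =>
    -- Here `n - 1` truncates to 0, harmlessly because `N` is constant.
    obtain ⟨x, rfl⟩ := natDegree_eq_zero.1 (Nat.le_zero.1 hN)
    exact ⟨fun _ => x, by simp [ratFun]⟩
  | succ n ih =>
    set Z : ℝ[X] := ∏ t ∈ range (n + 1), (X + C (-(t : ℝ))) with hZ
    have hZe : ∀ s : ℝ, Z.eval s = ∏ t ∈ range (n + 1), (s - t) := fun s => by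
      rw [hZ, eval_prod]; simp [sub_eq_add_neg]
    have hZ0 : Z.eval (-(e n)) ≠ 0 := by
      rw [hZe]
      refine prod_ne_zero_iff.2 fun t _ => ?_
      have := he n
      have : (0 : ℝ) ≤ t := Nat.cast_nonneg t
      linarith
    -- This choice makes `N - C v * Z` divisible by X + eₙ, cancelling the last pole. The
    -- coefficient `v` vanishes only if `N` does at that pole.
    set v := N.eval (-(e n)) / Z.eval (-(e n)) with hv
    have hroot : (N - C v * Z).IsRoot (-(e n)) := by
      rw [IsRoot.def, eval_sub, eval_mul, eval_C, hv, div_mul_cancel₀ _ hZ0, sub_self]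
    obtain ⟨u, hu, -⟩ := ih ((N - C v * Z) /ₘ (X - C (-(e n)))) (by
      rw [natDegree_divByMonic _ (monic_X_sub_C _), natDegree_X_sub_C, Nat.sub_le_iff_le_add]
      refine (natDegree_sub_le _ _).trans (max_le hN ((natDegree_C_mul_le _ _).trans ?_))
      rw [hZ, natDegree_prod_X_add_C])
    refine ⟨fun k => if k = n + 1 then v else u k, fun s => ?_, fun h => ?_⟩
    · rw [sum_range_succ]
      simp only [if_true]
      have h1 : ∑ k ∈ range (n + 1), (if k = n + 1 then v else u k) * ratFun e k s =
          ∑ k ∈ range (n + 1), u k * ratFun e k s :=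
        sum_congr rfl fun k hk => by rw [if_neg (mem_range.1 hk).ne]
      rw [h1, ← hu]
      have h2 := congrArg (eval (s : ℝ)) ((mul_divByMonic_eq_iff_isRoot).2 hroot)
      rw [eval_mul, eval_sub, eval_sub, eval_mul, eval_C, eval_C, eval_X, hZe] at h2
      have hs : (s : ℝ) + e n ≠ 0 := by have := he n; positivity
      have hD : ∏ t ∈ range n, ((s : ℝ) + e t) ≠ 0 :=
        (prod_pos fun t _ => by have := he t; positivity).ne'
      rw [ratFun, prod_div_distrib, prod_range_succ (fun t => (s : ℝ) + e t)]
      field_simp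
      linear_combination -h2
    · simp only [if_true]
      exact div_ne_zero (by simpa using h) hZ0

end Rational

/-! ### The walk as a composition of a pure death and two pure birth steps -/

section Walk

/-- A pure birth step: from `n`, move to `n + 1` with probability `(v n - u) / (n + v n)`. -/
def birth (u : ℝ) (v φ : ℕ → ℝ) (n : ℕ) : ℝ :=
  (u + n) / (n + v n) * φ n + (v n - u) / (n + v n) * φ (n + 1)

/-- A pure death step: from `n`, move to `n - 1` with probability `n / (n - 1 + v n)`. -/
def death (v φ : ℕ → ℝ) (n : ℕ) : ℝ :=
  -- At `n = 0` the first coefficient is 0, so the truncated index is immaterial.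
  n / (n - 1 + v n) * φ (n - 1) + (1 - n / (n - 1 + v n)) * φ n

/-- The transition operator of the walk. -/
def walk (a b : ℝ) (e : ℕ → ℝ) : (ℕ → ℝ) →ₗ[ℝ] ℕ → ℝ where
  -- The outermost operator acts first in time: a death step, then the birth step with `b`, then the
  -- one with `a`.
  toFun φ := death (fun i => e (i + 1)) (birth b (fun i => e (i + 1)) (birth a e φ))
  map_add' φ ψ := by
    funext n
    simp only [death, birth, Pi.add_apply]
    ring
  map_smul' x φ := by
    funext n
    simp only [death, birth, Pi.smul_apply, smul_eq_mul, RingHom.id_apply]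
    ring

/-- The transition matrix of the walk. -/
def kernel (a b : ℝ) (e : ℕ → ℝ) (n m : ℕ) : ℝ := walk a b e (Pi.single m 1) n

variable {a b : ℝ} {e : ℕ → ℝ}

lemma walk_congr {φ ψ : ℕ → ℝ} {n : ℕ} (h : ∀ m < n + 3, φ m = ψ m) :
    walk a b e φ n = walk a b e ψ n := by
  simp only [walk, LinearMap.coe_mk, AddHom.coe_mk, death, birth]
  rw [h n (by omega), h (n + 1) (by omega), h (n + 1 + 1) (by omega), h (n - 1) (by omega),
    h (n - 1 + 1) (by omega), h (n - 1 + 1 + 1) (by omega)]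

lemma walk_eq_sum (φ : ℕ → ℝ) (n : ℕ) :
    walk a b e φ n = ∑ m ∈ range (n + 3), kernel a b e n m * φ m := by
  have h : walk a b e φ n =
      walk a b e (∑ m ∈ range (n + 3), φ m • (Pi.single m 1 : ℕ → ℝ)) n := by
    refine walk_congr fun m hm => ?_
    simp [Finset.sum_apply, Pi.single_apply, hm]
  rw [h, map_sum, Finset.sum_apply]
  refine sum_congr rfl fun m _ => ?_
  rw [map_smul, Pi.smul_apply, smul_eq_mul, kernel, mul_comm]

lemma kernel_eq_zero {n m : ℕ} (h : n + 3 ≤ m) : kernel a b e n m = 0 := by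
  rw [kernel, walk_congr (ψ := 0) fun k hk => ?_, map_zero, Pi.zero_apply]
  rw [Pi.single_apply, if_neg (by omega), Pi.zero_apply]

/-- The parameters for which the walk is a Markov chain with jumps of size `2`. -/
structure IsAdmissible (a b : ℝ) (e : ℕ → ℝ) : Prop where
  pos_left : 0 < a
  pos_right : 0 < b
  pos : ∀ i, 0 < e i
  add_two : ∀ i, e (i + 2) = e i + 1
  -- Equality at `i = 0` is the case a = c; the jump from `n` to `n + 2` only involves `e (n + 1)`,
  -- where strictness holds.
  left_le : ∀ i, a ≤ e i
  left_lt : ∀ i, a < e (i + 1)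
  right_lt : ∀ i, b < e (i + 1)

/-- For state n + 1 the denominator is n + e(n + 2) = (n + 1) + e(n). -/
lemma IsAdmissible.death_prob_lt_one (h : IsAdmissible a b e) (n : ℕ) :
    (n : ℝ) / (n - 1 + e (n + 1)) < 1 := by
  rcases n with _ | n
  · simp
  · have h1 := h.add_two n
    have h2 := h.pos n
    have h3 : (0 : ℝ) ≤ n := Nat.cast_nonneg n
    rw [div_lt_one] <;> push_cast <;> rw [add_assoc n 1 1, h1] <;> linarith

lemma IsAdmissible.death_prob_nonneg (h : IsAdmissible a b e) (n : ℕ) :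
    0 ≤ (n : ℝ) / (n - 1 + e (n + 1)) := by
  rcases n with _ | n
  · simp
  · have h2 := h.pos (n + 2)
    push_cast
    rw [add_assoc n 1 1, add_sub_cancel_right]
    positivity

lemma birth_nonneg {u : ℝ} {v φ : ℕ → ℝ} (hu : 0 < u) (hv : ∀ i, u ≤ v i)
    (hφ : ∀ n, 0 ≤ φ n) (n : ℕ) : 0 ≤ birth u v φ n := by
  have h1 := hv n
  have h2 := sub_nonneg.2 h1
  have h3 : 0 ≤ v n := hu.le.trans h1
  have h4 := hφ n
  have h5 := hφ (n + 1)
  rw [birth]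
  positivity

lemma birth_one {u : ℝ} {v : ℕ → ℝ} (hv : ∀ i, 0 < v i) : birth u v 1 = 1 := by
  funext n
  have h1 : (n : ℝ) + v n ≠ 0 := by have := hv n; positivity
  simp only [birth, Pi.one_apply]
  field_simp
  ring

lemma IsAdmissible.kernel_nonneg (h : IsAdmissible a b e) (n m : ℕ) : 0 ≤ kernel a b e n m := by
  have h1 : ∀ n, 0 ≤ (Pi.single m 1 : ℕ → ℝ) n := fun n => by
    rw [Pi.single_apply]; split_ifs <;> norm_num
  have h2 := birth_nonneg h.pos_right (fun i => (h.right_lt i).le)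
    (birth_nonneg h.pos_left h.left_le h1)
  exact add_nonneg (mul_nonneg (h.death_prob_nonneg n) (h2 _))
    (mul_nonneg (sub_nonneg.2 (h.death_prob_lt_one n).le) (h2 _))

lemma IsAdmissible.hasSum_kernel (h : IsAdmissible a b e) (n : ℕ) :
    HasSum (kernel a b e n) 1 := by
  have h1 : ∑ m ∈ range (n + 3), kernel a b e n m = 1 := by
    have h2 := walk_eq_sum (a := a) (b := b) (e := e) 1 n
    simp only [Pi.one_apply, mul_one] at h2
    rw [← h2]
    simp only [walk, LinearMap.coe_mk, AddHom.coe_mk]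
    rw [birth_one h.pos, birth_one fun i => h.pos (i + 1)]
    simp [death]
  rw [← h1]
  exact hasSum_sum_of_ne_finset_zero fun m hm => kernel_eq_zero (by simpa using hm)

lemma IsAdmissible.isStochastic_kernel (h : IsAdmissible a b e) : IsStochastic (kernel a b e) :=
  ⟨h.kernel_nonneg, h.hasSum_kernel⟩

lemma IsAdmissible.kernel_add_two_pos (h : IsAdmissible a b e) (n : ℕ) :
    0 < kernel a b e n (n + 2) := by
  have h1 := sub_pos.2 (h.death_prob_lt_one n)
  have h2 := sub_pos.2 (h.right_lt n)
  have h3 := sub_pos.2 (h.left_lt n)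
  have h4 := h.pos (n + 1)
  have h5 : kernel a b e n (n + 2) = (1 - n / (n - 1 + e (n + 1))) *
      ((e (n + 1) - b) / (n + e (n + 1)) * ((e (n + 1) - a) / ((n + 1 : ℕ) + e (n + 1)))) := by
    simp only [kernel, walk, LinearMap.coe_mk, AddHom.coe_mk, death, birth, Pi.single_apply]
    rw [if_true, if_neg (by omega : ¬ n = n + 2), if_neg (by omega : ¬ n + 1 = n + 2)]
    rcases n with _ | n
    · simp
    · rw [Nat.add_sub_cancel, if_neg (by omega : ¬ n = n + 1 + 2),
        if_neg (by omega : ¬ n + 1 = n + 1 + 2), if_neg (by omega : ¬ n + 1 + 1 = n + 1 + 2)]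
      ring
  rw [h5]
  positivity

/-- The birth probabilities are fitted to the identity (u + n)(s + eₙ) + (eₙ - u)(s - n) = (n +
eₙ)(u + s). -/
lemma birth_ratFun (he : ∀ i, 0 < e i) (u : ℝ) (s : ℕ) :
    birth u e (fun n => ratFun e n s) = fun n => (u + s) / (s + e n) * ratFun e n s := by
  funext n
  have h1 : (s : ℝ) + e n ≠ 0 := by have := he n; positivity
  have h2 : (n : ℝ) + e n ≠ 0 := by have := he n; positivity
  rw [birth, ratFun_succ]
  field_simp
  ring

/-- Up to the factor 1 / (s + e₀), dividing rₙ(s) by s + eₙ gives the analogous function with poles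
shifted to e₁, e₂, …, so the same mechanism applies with the shifted sequence. -/
lemma birth_birth_ratFun (he : ∀ i, 0 < e i) (u v : ℝ) (s : ℕ) :
    birth v (fun i => e (i + 1)) (birth u e (fun n => ratFun e n s)) = fun n =>
      (u + s) * (v + s) / ((s + e n) * (s + e (n + 1))) * ratFun e n s := by
  funext n
  rw [birth_ratFun he]
  have h1 : (s : ℝ) + e n ≠ 0 := by have := he n; positivity
  have h2 : (n : ℝ) + e (n + 1) ≠ 0 := by have := he (n + 1); positivity
  have h3 : (s : ℝ) + e (n + 1) ≠ 0 := by have := he (n + 1); positivity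
  rw [birth, ratFun_succ]
  field_simp
  ring

/-- Replacing s by s + 1 moves the poles two places along the sequence, since s + 1 + eᵢ = s + eᵢ₊₂,
and adds the zero s = -1. -/
lemma ratFun_succ_add_one (he : ∀ i, 0 < e i) (he2 : ∀ i, e (i + 2) = e i + 1) (k s : ℕ) :
    ratFun e (k + 1) (s + 1) / ((s + e 0) * (s + e 1)) =
      (s + 1) * ratFun e k s / ((s + e k) * (s + e (k + 1)) * (s + e (k + 2))) := by
  have hpos : ∀ i, (s : ℝ) + e i ≠ 0 := fun i => by have := he i; positivity
  induction k with
  | zero =>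
    rw [ratFun_succ, ratFun_zero, ratFun_zero, zero_add, he2 0]
    have h0 := hpos 0
    have h1 := hpos 1
    have h2 := hpos 2
    rw [he2 0] at h2
    have h3 : (s : ℝ) + 1 + e 0 ≠ 0 := by rwa [add_right_comm, add_assoc]
    push_cast
    field_simp
    ring
  | succ k ih =>
    rw [ratFun_succ, mul_div_right_comm, ih, ratFun_succ e k, he2 (k + 1)]
    have h0 := hpos k
    have h1 := hpos (k + 1)
    have h2 := hpos (k + 2)
    have h3 := hpos (k + 3)
    rw [show k + 3 = k + 1 + 2 from rfl, he2 (k + 1)] at h3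
    have h4 : (s : ℝ) + 1 + e (k + 1) ≠ 0 := by
      rwa [add_right_comm, add_assoc]
    rw [show k + 1 + 1 = k + 2 from rfl]
    push_cast
    field_simp
    ring

/-- The functions `ratFun e n` are mapped to their shifts by the transition operator. -/
lemma IsAdmissible.walk_ratFun (h : IsAdmissible a b e) (n s : ℕ) :
    walk a b e (fun n => ratFun e n s) n =
      (a + s) * (b + s) / ((s + e 0) * (s + e 1)) * ratFun e n (s + 1 : ℕ) := by
  simp only [walk, LinearMap.coe_mk, AddHom.coe_mk]
  rw [birth_birth_ratFun h.pos]
  rcases n with _ | k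
  · simp [death, ratFun_zero]
  · have h1 := ratFun_succ_add_one h.pos h.add_two k s
    have hpos : ∀ i, (s : ℝ) + e i ≠ 0 := fun i => by have := h.pos i; positivity
    have h2 : (k : ℝ) + e (k + 2) ≠ 0 := by have := h.pos (k + 2); positivity
    have e0 := hpos k
    have e1 := hpos (k + 1)
    have e2 := hpos (k + 2)
    rw [Nat.cast_succ s, div_mul_eq_mul_div, mul_div_assoc, h1]
    -- With e = e(k + 2), what remains is (k + 1)(s + e) + (e - 1)(s - k) = (k + e)(s + 1).
    rw [death, ratFun_succ]
    simp only [Nat.add_sub_cancel, show k + 1 + 1 = k + 2 from rfl]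
    push_cast
    rw [add_sub_cancel_right]
    field_simp
    ring

end Walk

/-! ### Existence of the Gauss--Borel factorization -/

lemma isAdmissible_interlace {a b c d : ℝ} (ha : 0 < a) (hb : 0 < b) (hda : a < d) (hdb : b < d)
    (hca : a ≤ c) (hcb : b ≤ c + 1) (hcb₁ : c + 1 ≠ b) : IsAdmissible a b (interlace c d) := by
  have hc : 0 < c := ha.trans_le hca
  have hcb' : b < c + 1 := lt_of_le_of_ne hcb (Ne.symm hcb₁)
  have h1 : ∀ (w : ℝ), w < c + 1 → w < d → ∀ i, w < interlace c d (i + 1) := by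
    intro w hw hw' i
    have : (0 : ℝ) ≤ (i / 2 : ℕ) := Nat.cast_nonneg _
    rcases Nat.even_or_odd' i with ⟨k, rfl | rfl⟩
    · rw [interlace_two_mul_add_one]
      linarith [(Nat.cast_nonneg k : (0 : ℝ) ≤ k)]
    · rw [show 2 * k + 1 + 1 = 2 * (k + 1) by ring, interlace_two_mul]
      push_cast
      linarith [(Nat.cast_nonneg k : (0 : ℝ) ≤ k)]
  refine ⟨ha, hb, interlace_lt hc (ha.trans hda), interlace_add_two c d, fun i => ?_,
    h1 a (by linarith) hda, h1 b hcb' hdb⟩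
  rcases i with _ | i
  · simpa [interlace] using hca
  · exact (h1 a (by linarith) hda i).le

/-- Ensures that the numerator of column n + 1 of the moment matrix does not vanish at its last pole
-eₙ. The delicate cases are b + i = c + i and b + i = c + i + 1. -/
lemma interlace_ne {a b c d : ℝ} (hda : a < d) (hdb : b < d) (hca : a ≤ c) (hcb : b ≤ c + 1)
    (hcb₀ : c ≠ b) (hcb₁ : c + 1 ≠ b) {t n : ℕ} (htn : t ≤ n) :
    interlace b a t ≠ interlace c d n := by
  have hcb' : b < c + 1 := lt_of_le_of_ne hcb (Ne.symm hcb₁)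
  rcases Nat.even_or_odd' t with ⟨i, rfl | rfl⟩ <;> rcases Nat.even_or_odd' n with ⟨m, rfl | rfl⟩ <;>
    simp only [interlace_two_mul, interlace_two_mul_add_one] <;> intro heq
  · rcases (by omega : i ≤ m).eq_or_lt with rfl | hlt
    · exact hcb₀ (by linarith)
    · have : (i : ℝ) + 1 ≤ m := by exact_mod_cast hlt
      linarith
  · have : (i : ℝ) ≤ m := by exact_mod_cast (by omega : i ≤ m)
    linarith
  · have : (i : ℝ) + 1 ≤ m := by exact_mod_cast (by omega : i + 1 ≤ m)
    linarith
  · have : (i : ℝ) ≤ m := by exact_mod_cast (by omega : i ≤ m)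
    linarith

open Polynomial in
/-- The moment matrix has a Gauss--Borel factorization. -/
theorem exists_isGaussBorel {a b c d : ℝ} (ha : 0 < a) (hb : 0 < b) (hda : a < d) (hdb : b < d)
    (hca : a ≤ c) (hcb : b ≤ c + 1) (hcb₀ : c ≠ b) (hcb₁ : c + 1 ≠ b) :
    ∃ (S : ℕ → ℕ → ℝ) (H : ℕ → ℝ) (St : ℕ → ℕ → ℝ),
      IsGaussBorel (moment a b c d) S H St := by
  have hc : 0 < c := ha.trans_le hca
  have hd : 0 < d := ha.trans hda
  have hδ : 0 < delta a b c d := by rw [delta]; linarith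
  set e := interlace c d with he_def
  set f := interlace b a with hf_def
  have he : ∀ i, 0 < e i := interlace_lt hc hd
  set κ : ℕ → ℝ := fun j => if Even j then 1 else c / b with hκ_def
  have hκ : ∀ j, κ j ≠ 0 := fun j => by
    simp only [hκ_def]; split_ifs <;> positivity
  set N : ℕ → ℝ[X] := fun j => C (κ j) * ∏ t ∈ range j, (X + C (f t)) with hN_def
  have hN : ∀ j, (N j).natDegree ≤ j := fun j =>
    (natDegree_C_mul_le _ _).trans (natDegree_prod_X_add_C f j).le
  have hNe : ∀ (j : ℕ) (x : ℝ), (N j).eval x = κ j * ∏ t ∈ range j, (x + f t) := fun j x => by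
    simp [hN_def, eval_prod]
  choose u hu hu0 using fun j => exists_sum_ratFun he j (N j) (hN j)
  have hR : ∀ s, momentSeq a b c d s ≠ 0 := fun s => (momentSeq_pos ha hb hc hd s).ne'
  have hr : ∀ k : ℕ, ratFun e k k ≠ 0 := fun k => (ratFun_self_pos he k).ne'
  -- Expanding column j in r₀, …, r_j is already an LU factorization: r_k vanishes at s < k, and the
  -- coefficient of r_j is nonzero.
  refine ⟨_, _, _, isGaussBorel_of_mul
    (L := fun s k => momentSeq a b c d s * ratFun e k s / (momentSeq a b c d k * ratFun e k k))
    (U := fun k j => if k ≤ j then momentSeq a b c d k * ratFun e k k * u j k else 0)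
    ⟨fun i => div_self (mul_ne_zero (hR i) (hr i)), fun i j hij => ?_⟩
    (fun i j hij => if_neg (by omega)) (fun i => ?_) fun s j => ?_⟩
  · rw [ratFun_eq_zero e hij, mul_zero, zero_div]
  · simp only [le_refl, if_true]
    refine mul_ne_zero (mul_ne_zero (hR i) (hr i)) (hu0 i ?_)
    rw [hNe]
    refine mul_ne_zero (hκ i) (prod_ne_zero_iff.2 fun t ht => ?_)
    rw [neg_add_eq_sub, sub_ne_zero]
    exact interlace_ne hda hdb hca hcb hcb₀ hcb₁ (by simp at ht; omega)
  · rw [moment_eq ha hb hc hd hδ, prod_div_distrib, ← mul_div_assoc, ← hNe, hu, mul_sum]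
    refine sum_congr rfl fun k hk => ?_
    rw [if_pos (by simpa [Nat.lt_succ_iff] using hk)]
    have := hR k
    have := hr k
    field_simp

/-! ### The inverse of `S` and the Jacobi matrix -/

lemma sum_range_succ_parity (g : ℕ → ℝ) (m : ℕ) : ∑ j ∈ range (m + 1), g j =
    ∑ i ∈ range (m / 2 + 1), g (2 * i) + ∑ i ∈ range ((m + 1) / 2), g (2 * i + 1) := by
  induction m with
  | zero => simp
  | succ m ih =>
    rw [sum_range_succ, ih]
    rcases Nat.even_or_odd' m with ⟨k, rfl | rfl⟩
    · rw [show (2 * k + 1) / 2 = k by omega, show 2 * k / 2 = k by omega,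
        show (2 * k + 1 + 1) / 2 = k + 1 by omega, sum_range_succ (fun i => g (2 * i + 1))]
      ring
    · rw [show (2 * k + 1) / 2 = k by omega, show (2 * k + 1 + 1) / 2 = k + 1 by omega,
        show (2 * k + 1 + 1 + 1) / 2 = k + 1 by omega, sum_range_succ (fun i => g (2 * i)) (k + 1),
        show 2 * (k + 1) = 2 * k + 1 + 1 by ring]
      ring

/-- Both hypergeometric functions equal 1 at argument 0, so the weights at 1 are the constants in
`moment_eq`. -/
lemma linearForm_one (a b c d : ℝ) (H : ℕ → ℝ) (St : ℕ → ℕ → ℝ) (m : ℕ) :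
    linearForm a b c d H St m 1 =
      ∑ j ∈ range (m + 1), (H m)⁻¹ * St m j * if Even j then 1 else c / b := by
  have h1 : ∀ i : ℕ, ¬ Even (2 * i + 1) := fun i => by simp
  rw [sum_range_succ_parity]
  simp only [h1, if_false]
  simp [linearForm, w₁, w₂, typeI₁, typeI₂, Polynomial.eval_finsetSum, mul_sum, mul_comm]

/-- The matrix `S⁻¹` in closed form. -/
lemma IsGaussBorel.lowerInv_eq_ratFun {a b c d : ℝ} (ha : 0 < a) (hb : 0 < b) (hc : 0 < c)
    (hd : 0 < d) (hδ : 0 < delta a b c d) {S : ℕ → ℕ → ℝ} {H : ℕ → ℝ} {St : ℕ → ℕ → ℝ}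
    (h : IsGaussBorel (moment a b c d) S H St) (s m : ℕ) :
    HypergeometricWalk.lowerInv S s m = momentSeq a b c d s *
      (linearForm a b c d H St m 1 * ratFun (interlace c d) m s) := by
  have h1 : ∀ s : ℕ, HypergeometricWalk.lowerInv S s m = momentSeq a b c d s *
      ∑ j ∈ range (m + 1), ((H m)⁻¹ * St m j * if Even j then 1 else c / b) *
        ∏ t ∈ range j, ((s : ℝ) + interlace b a t) / (s + interlace c d t) := by
    intro s
    rw [h.lowerInv_eq, mul_sum]
    refine sum_congr rfl fun j _ => ?_
    rw [moment_eq ha hb hc hd hδ]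
    ring
  -- The zeros at 0, …, m - 1 come from the triangularity of S⁻¹; the sum of coefficients is the
  -- linear form at 1.
  rw [h1, sum_prod_div_eq_ratFun (interlace_lt hc hd), linearForm_one]
  intro i hi
  have h2 := h1 i
  rw [h.left.lowerInv.lower _ _ hi] at h2
  exact (mul_eq_zero.1 h2.symm).resolve_left (momentSeq_pos ha hb hc hd i).ne'

/-! ### Asymptotics of the return probabilities -/

section Asymptotics

variable {a b c d : ℝ}

/-- Four Euler limits give `k = 0`; shifting the index multiplies by a ratio tending to 1. -/
lemma tendsto_momentSeq_mul_rpow (hc : 0 < c) (hd : 0 < d) (k : ℕ) :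
    Tendsto (fun r : ℕ => momentSeq a b c d (r + 1 + k) * (r : ℝ) ^ delta a b c d) atTop
      (𝓝 (Real.Gamma c * Real.Gamma d * ((Real.Gamma a)⁻¹ * (Real.Gamma b)⁻¹))) := by
  induction k with
  | zero =>
    have h1 := ((tendsto_poch_div a).mul (tendsto_poch_div b)).div
      ((tendsto_poch_div c).mul (tendsto_poch_div d))
      (mul_ne_zero (inv_ne_zero (Real.Gamma_pos_of_pos hc).ne')
        (inv_ne_zero (Real.Gamma_pos_of_pos hd).ne'))
    rw [← mul_inv (Real.Gamma c), div_inv_eq_mul, mul_comm] at h1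
    refine h1.congr' ?_
    filter_upwards [eventually_gt_atTop 0] with n hn
    have hn' : (0 : ℝ) < n := by exact_mod_cast hn
    have pc := (poch_pos hc (n + 1)).ne'
    have pd := (poch_pos hd (n + 1)).ne'
    have h3 : (n.factorial : ℝ) ≠ 0 := by positivity
    have ea := (Real.rpow_pos_of_pos hn' a).ne'
    have eb := (Real.rpow_pos_of_pos hn' b).ne'
    have ec := (Real.rpow_pos_of_pos hn' c).ne'
    have ed := (Real.rpow_pos_of_pos hn' d).ne'
    rw [delta, Real.rpow_sub hn', Real.rpow_sub hn', Real.rpow_add hn', momentSeq]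
    simp only [Pi.div_apply, add_zero]
    field_simp
  | succ k ih =>
    have hs : Tendsto (fun r : ℕ => ((r + 1 + k : ℕ) : ℝ)) atTop atTop :=
      tendsto_natCast_atTop_atTop.comp
        ((tendsto_add_atTop_nat k).comp (tendsto_add_atTop_nat 1))
    have hratio : ∀ u v : ℝ, Tendsto (fun r : ℕ => (u + (r + 1 + k : ℕ)) / (v + (r + 1 + k : ℕ)))
        atTop (𝓝 1) := by
      intro u v
      have h1 := tendsto_atTop_add_const_left _ v hs
      have h2 : Tendsto (fun r : ℕ => 1 + (u - v) / (v + (r + 1 + k : ℕ))) atTop (𝓝 (1 + 0)) :=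
        tendsto_const_nhds.add (h1.const_div_atTop _)
      rw [add_zero] at h2
      refine h2.congr' ?_
      filter_upwards [h1.eventually_gt_atTop 0] with r hr
      rw [eq_div_iff hr.ne', add_mul, div_mul_cancel₀ _ hr.ne']
      ring
    have h2 := ih.mul ((hratio a c).mul (hratio b d))
    rw [mul_one, mul_one] at h2
    refine h2.congr fun r => ?_
    rw [← add_assoc, momentSeq_succ, div_mul_div_comm]
    ring

lemma summable_iff_of_tendsto_mul_rpow {u : ℕ → ℝ} {K δ : ℝ} (hK : K ≠ 0)
    (h : Tendsto (fun r : ℕ => u (r + 1) * (r : ℝ) ^ δ) atTop (𝓝 K)) :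
    Summable u ↔ 1 < δ := by
  rw [← summable_nat_add_iff 1]
  have h1 : Asymptotics.IsEquivalent atTop (fun r => u (r + 1))
      fun r : ℕ => K * (r : ℝ) ^ (-δ) := by
    have h2 := h.div_const K
    rw [div_self hK] at h2
    have hne : ∀ᶠ r : ℕ in atTop, K * (r : ℝ) ^ (-δ) ≠ 0 := by
      filter_upwards [eventually_gt_atTop 0] with r hr
      exact mul_ne_zero hK (Real.rpow_pos_of_pos (by exact_mod_cast hr) _).ne'
    rw [Asymptotics.isEquivalent_iff_tendsto_one hne]
    refine h2.congr' ?_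
    filter_upwards [eventually_gt_atTop 0] with r hr
    have hr' : (0 : ℝ) < r := by exact_mod_cast hr
    have := (Real.rpow_pos_of_pos hr' δ).ne'
    rw [Pi.div_apply, Real.rpow_neg hr'.le]
    field_simp
  rw [h1.summable_iff_nat, summable_mul_left_iff hK, Real.summable_nat_rpow, neg_lt_neg_iff]

end Asymptotics

/-! ### The two chains -/

section Chains

variable {S : ℕ → ℕ → ℝ} {q : ℕ → ℝ}

lemma eval_typeII (S : ℕ → ℕ → ℝ) (n : ℕ) :
    (typeII S n).eval 1 = ∑ k ∈ range (n + 1), S n k := by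
  simp [typeII, Polynomial.eval_finsetSum]

/-- The recurrence J B = x B at x = 1. -/
lemma sum_jacobi_mul_typeII (hS : IsLowerUnitriangular S) (n : ℕ) :
    ∑ m ∈ range (n + 2), jacobi S n m * (typeII S m).eval 1 = (typeII S n).eval 1 := by
  have h : ∀ m ∈ range (n + 2), jacobi S n m * (typeII S m).eval 1 =
      ∑ p ∈ range (n + 2), jacobi S n m * S m p := fun m hm => by
    rw [eval_typeII, mul_sum]
    refine (sum_truncate (by simp at hm; omega) fun p hp => ?_).symm
    rw [hS.lower _ _ hp, mul_zero]
  rw [sum_congr rfl h, sum_comm]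
  simp only [jacobi_mul hS]
  rw [sum_comm, eval_typeII]
  refine sum_congr rfl fun k hk => ?_
  rw [← mul_sum, sum_ite_eq, if_pos (by simp at hk ⊢; omega), mul_one]

/-- Powers of the transition matrix of type II. -/
lemma matPow_transitionII (hS : IsLowerUnitriangular S) (hB : ∀ n, (typeII S n).eval 1 ≠ 0)
    (r n m : ℕ) : matPow (transitionII S) r n m =
      (typeII S m).eval 1 / (typeII S n).eval 1 * jacobiPow S r n m := by
  induction r generalizing n with
  | zero =>
    rw [jacobiPow_zero hS, matPow]
    split_ifs with h
    · subst h; rw [div_self (hB n), mul_one]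
    · rw [mul_zero]
  | succ r ih =>
    rw [matPow, tsum_eq_sum (s := range (n + 2)), ← jacobi_mul_jacobiPow hS, mul_sum]
    · refine sum_congr rfl fun k _ => ?_
      rw [ih, transitionII]
      have := hB k
      have := hB n
      field_simp
    · intro k hk
      rw [transitionII, jacobi_eq_zero hS (by simp at hk; omega), mul_zero, zero_mul]

/-- Powers of the transition matrix of type I, for `q` the values of the linear forms at `1`. -/
lemma matPow_transpose (hS : IsLowerUnitriangular S) (hq : ∀ n, q n ≠ 0) {P : ℕ → ℕ → ℝ}
    (hP : ∀ n m, P n m = q m / q n * jacobi S m n)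
    (hP0 : ∀ n m, n + 3 ≤ m → P n m = 0) (r n m : ℕ) :
    matPow P r n m = q m / q n * jacobiPow S r m n := by
  induction r generalizing n with
  | zero =>
    rw [jacobiPow_zero hS, matPow]
    simp only [eq_comm (a := n)]
    split_ifs with h
    · subst h; rw [div_self (hq m), mul_one]
    · rw [mul_zero]
  | succ r ih =>
    have hlow : ∀ k, m + r + 1 ≤ k → jacobiPow S r m k = 0 := fun k hk =>
      sum_eq_zero fun l hl => by
        rw [hS.lowerInv.lower _ _ (by simp at hl; omega), mul_zero]
    rw [matPow, tsum_eq_sum (s := range (max (n + 3) (m + r + 1))), ← jacobiPow_mul_jacobi hS,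
      ← sum_truncate (le_max_right (n + 3) (m + r + 1)), mul_sum]
    · refine sum_congr rfl fun k _ => ?_
      rw [ih, hP]
      have := hq k
      have := hq n
      field_simp
    · intro k hk
      rw [hlow k hk, zero_mul]
    · intro k hk
      rw [hP0 n k (by simp at hk; omega), zero_mul]

end Chains

/-- The type I transition matrix is the transition matrix of the composed walk. -/
lemma mul_jacobi_eq_kernel {a b c d : ℝ} {e q : ℕ → ℝ} {S : ℕ → ℕ → ℝ}
    (hadm : IsAdmissible a b e) (he0 : e 0 = c) (he1 : e 1 = d) (hS : IsLowerUnitriangular S)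
    (hq : ∀ n, q n ≠ 0)
    (hL : ∀ s m : ℕ, lowerInv S s m = momentSeq a b c d s * (q m * ratFun e m s)) (n m : ℕ) :
    q m / q n * jacobi S m n = kernel a b e n m := by
  -- Multiplied by `momentSeq a b c d k`, `walk_ratFun` becomes a relation between consecutive rows
  -- of S⁻¹; multiplying by S then gives J = S Λ S⁻¹.
  have h1 : ∀ k, lowerInv S (k + 1) n =
      ∑ p ∈ range (n + 3), kernel a b e n p * (q n / q p) * lowerInv S k p := by
    intro k
    have h2 := hadm.walk_ratFun n k
    rw [walk_eq_sum, he0, he1] at h2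
    rw [hL, momentSeq_succ, add_comm c, add_comm d]
    calc _ = momentSeq a b c d k * q n * ((a + k) * (b + k) / ((k + c) * (k + d)) *
          ratFun e n (k + 1 : ℕ)) := by ring
      _ = _ := by
          rw [← h2, mul_sum]
          refine sum_congr rfl fun p _ => ?_
          rw [hL]
          have := hq p
          field_simp
  have h3 : jacobi S m n = kernel a b e n m * (q n / q m) := by
    simp only [jacobi, h1, mul_sum]
    rw [sum_comm]
    have h4 : ∀ p, ∑ k ∈ range (m + 1), S m k * (kernel a b e n p * (q n / q p) * lowerInv S k p) =
        if m = p then kernel a b e n p * (q n / q p) else 0 := by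
      intro p
      have h5 := mul_lowerInv hS m p
      rw [← mul_boole, ← h5, mul_sum]
      exact sum_congr rfl fun _ _ => by ring
    simp only [h4]
    rw [sum_ite_eq]
    split_ifs with hm
    · rfl
    · rw [kernel_eq_zero (by simpa using hm), zero_mul]
  rw [h3]
  have := hq m
  have := hq n
  field_simp

end HypergeometricWalk

end

open HypergeometricWalk in
theorem mainTheorem6 (a b c d : ℝ) (ha : 0 < a) (hb : 0 < b) (hda : a < d) (hdb : b < d)
    (hca : a ≤ c) (hcb : b ≤ c + 1) (hcb₀ : c ≠ b) (hcb₁ : c + 1 ≠ b) :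
    (∃ (S : ℕ → ℕ → ℝ) (H : ℕ → ℝ) (St : ℕ → ℕ → ℝ),
      IsGaussBorel (moment a b c d) S H St) ∧
    ∀ (S : ℕ → ℕ → ℝ) (H : ℕ → ℝ) (St : ℕ → ℕ → ℝ),
      IsGaussBorel (moment a b c d) S H St →
      (∀ n, 0 < (typeII S n).eval 1) ∧
      (∀ n, 0 < linearForm a b c d H St n 1) ∧
      IsStochastic (transitionI a b c d S H St) ∧
      IsStochastic (transitionII S) ∧
      (0 < delta a b c d ∧ delta a b c d ≤ 1 →
        IsRecurrent (transitionI a b c d S H St) ∧ IsRecurrent (transitionII S)) ∧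
      (1 < delta a b c d →
        IsTransient (transitionI a b c d S H St) ∧ IsTransient (transitionII S)) := by
  refine ⟨exists_isGaussBorel ha hb hda hdb hca hcb hcb₀ hcb₁, fun S H St h => ?_⟩
  have hc : 0 < c := ha.trans_le hca
  have hd : 0 < d := ha.trans hda
  have hδ : 0 < delta a b c d := by rw [delta]; linarith
  have hadm := isAdmissible_interlace ha hb hda hdb hca hcb hcb₁
  set e := interlace c d with he_def
  set q : ℕ → ℝ := fun n => linearForm a b c d H St n 1 with hq_def
  have hS := h.left
  have hL : ∀ s m : ℕ, lowerInv S s m = momentSeq a b c d s * (q m * ratFun e m s) :=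
    h.lowerInv_eq_ratFun ha hb hc hd hδ
  have hR := momentSeq_pos ha hb hc hd
  have hq : ∀ n, 0 < q n := fun n => by
    have h1 := hL n n
    rw [hS.lowerInv.diag] at h1
    have h2 := mul_pos (hR n) (ratFun_self_pos hadm.pos n)
    refine pos_of_mul_pos_left (a := q n) (b := momentSeq a b c d n * ratFun e n n) ?_ h2.le
    rw [show q n * (momentSeq a b c d n * ratFun e n n) = 1 by rw [h1]; ring]
    exact one_pos
  have hker : ∀ n m, transitionI a b c d S H St n m = kernel a b e n m := fun n m =>
    mul_jacobi_eq_kernel hadm (by simp [he_def, interlace]) (by simp [he_def, interlace]) hS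
      (fun n => (hq n).ne') hL n m
  have hI : transitionI a b c d S H St = kernel a b e := funext fun n => funext fun m => hker n m
  have hstoI : IsStochastic (kernel a b e) := hadm.isStochastic_kernel
  have hJ : ∀ n m, jacobi S m n = q n / q m * kernel a b e n m := fun n m => by
    rw [← hker]
    have := (hq n).ne'
    have := (hq m).ne'
    change _ = q n / q m * (q m / q n * jacobi S m n)
    field_simp
  have hB : ∀ n, 0 < (typeII S n).eval 1 := by
    -- This product is invariant for the type I chain, and equals `q 0` at the origin as B^(0) = 1.
    have hpi : ∀ n, 0 < (typeII S n).eval 1 * q n := by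
      refine invariant_pos hstoI (fun m n hmn => ?_) (fun n => ?_) hadm.kernel_add_two_pos ?_
        fun n => ?_
      · rw [← hker, transitionI, jacobi_eq_zero hS hmn, mul_zero]
      · rw [← hker, transitionI, jacobi_succ hS, mul_one]
        exact div_pos (hq _) (hq _)
      · rw [eval_typeII]
        simpa [hS.diag] using hq 0
      · rw [← sum_jacobi_mul_typeII hS, Finset.sum_mul]
        refine Finset.sum_congr rfl fun m _ => ?_
        rw [hJ]
        have := (hq m).ne'
        have := (hq n).ne'
        field_simp
    exact fun n => pos_of_mul_pos_left (hpi n) (hq n).le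
  have hstoII : IsStochastic (transitionII S) := by
    refine ⟨fun n m => mul_nonneg (div_pos (hB m) (hB n)).le ?_, fun n => ?_⟩
    · rw [hJ]
      exact mul_nonneg (div_pos (hq _) (hq _)).le (hstoI.nonneg _ _)
    · have h1 : ∑ m ∈ Finset.range (n + 2), transitionII S n m = 1 := by
        refine mul_right_cancel₀ (hB n).ne' ?_
        rw [Finset.sum_mul, one_mul]
        refine Eq.trans ?_ (sum_jacobi_mul_typeII hS n)
        refine Finset.sum_congr rfl fun m _ => ?_
        rw [transitionII]
        have := (hB n).ne'
        field_simp
      rw [← h1]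
      refine hasSum_sum_of_ne_finset_zero fun m hm => ?_
      rw [transitionII, jacobi_eq_zero hS (by simp at hm; omega), mul_zero]
  have hfinI : ∀ i, (Function.support (kernel a b e i)).Finite := fun i =>
    (Set.finite_lt_nat (i + 3)).subset fun m hm => by
      by_contra hlt
      exact hm (kernel_eq_zero (not_lt.mp hlt))
  have hfinII : ∀ i, (Function.support (transitionII S i)).Finite := fun i =>
    (Set.finite_lt_nat (i + 2)).subset fun m hm => by
      by_contra hlt
      refine hm ?_
      rw [transitionII, jacobi_eq_zero hS (by simp at hlt; omega), mul_zero]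
  have hpowI : ∀ j r, matPow (kernel a b e) r j j = jacobiPow S r j j := fun j r => by
    rw [matPow_transpose hS (fun n => (hq n).ne') (fun n m => (hker n m).symm)
      (fun n m hnm => kernel_eq_zero hnm), div_self (hq j).ne', one_mul]
  have hpowII : ∀ j r, matPow (transitionII S) r j j = jacobiPow S r j j := fun j r => by
    rw [matPow_transitionII hS fun n => (hB n).ne', div_self (hB j).ne', one_mul]
  have hsum : ∀ j, Summable (fun r => jacobiPow S r j j) ↔ 1 < delta a b c d := fun j => by
    -- The limit `K` is B^(j)(1) q^(j)(1) Γ(c)Γ(d) / (Γ(a)Γ(b)), positive by what precedes.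
    refine summable_iff_of_tendsto_mul_rpow (K := ∑ k ∈ Finset.range (j + 1), S j k *
      (Real.Gamma c * Real.Gamma d * ((Real.Gamma a)⁻¹ * (Real.Gamma b)⁻¹) * (q j * 1))) ?_ ?_
    · rw [← Finset.sum_mul, ← eval_typeII]
      have := Real.Gamma_pos_of_pos ha
      have := Real.Gamma_pos_of_pos hb
      have := Real.Gamma_pos_of_pos hc
      have := Real.Gamma_pos_of_pos hd
      have := hB j
      have := hq j
      positivity
    · simp only [jacobiPow, Finset.sum_mul]
      refine tendsto_finsetSum _ fun k _ => ?_
      have h1 := (tendsto_ratFun e j).comp (tendsto_natCast_atTop_atTop.comp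
        ((Filter.tendsto_add_atTop_nat k).comp (Filter.tendsto_add_atTop_nat 1)))
      refine (((tendsto_momentSeq_mul_rpow hc hd k).mul (h1.const_mul (q j))).const_mul
        (S j k)).congr fun r => ?_
      rw [hL, show k + (r + 1) = r + 1 + k by omega]
      simp only [Function.comp_apply]
      ring
  rw [hI]
  refine ⟨hB, hq, hstoI, hstoII, fun hδ1 => ⟨?_, ?_⟩, fun hδ1 => ⟨?_, ?_⟩⟩
  · refine isRecurrent_of_not_summable hfinI hstoI fun j => ?_
    simp only [hpowI, hsum, not_lt, hδ1.2]
  · refine isRecurrent_of_not_summable hfinII hstoII fun j => ?_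
    simp only [hpowII, hsum, not_lt, hδ1.2]
  · refine isTransient_of_summable hfinI hstoI fun j => ?_
    simp only [hpowI, hsum, hδ1]
  · refine isTransient_of_summable hfinII hstoII fun j => ?_
    simp only [hpowII, hsum, hδ1]
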